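/- Let $n\in\mathbb N$, $k\in\mathbb R$, and let $f\colon\mathbb R^n\to\mathbb R$ be a $C^2$ function with $\nabla^2 f\equiv k\,\mathrm{Id}$. Consider the weighted Euclidean space $(\mathbb R^n,|\cdot|,\mathfrak m)$ with $\mathfrak m=e^{-f}\mathcal L^n$, and its weighted Laplacian $\Delta_f u=\Delta u-\langle\nabla f,\nabla u\rangle$. Let $p_t(x,y)$, $t>0$, denote its heat kernel: for each $x$, $(t,y)\mapsto p_t(x,y)$ is the minimal non-negative fundamental solution with source $x$, that is, the pointwise smallest function $u\ge 0$ that is smooth on $(0,\infty)\times\mathbb R^n$, satisfies $\partial_t u=\Delta_f u$ there, and satisfies $\int u(t,y)\varphi(y)\,\mathfrak m(dy)\to\varphi(x)$ as $t\to0^+$ for every $\varphi\in C_c^\infty(\mathbb R^n)$. Write $p_t(x,\cdot)$ for the measure $p_t(x,z)\,\mathfrak m(dz)$, and, for $p\in[1,\infty]$, let $W_p(\mu,\nu)$ be the infimum of $\|d\|_{L^p(\pi)}$, $d(z,w)=|z-w|$, over all couplings $\pi$ of $\mu$ and $\nu$. Then the heat kernel exists, each $p_t(x,\cdot)$ is a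 probability measure, and for all $x,y\in\mathbb R^n$, $t>0$ and $p\in[1,\infty]$, $$W_p\big(p_t(x,\cdot),p_t(y,\cdot)\big)=e^{-kt}|x-y|.$$ Moreover, $p_t(x,\cdot)$ is the Ornstein–Uhlenbeck (Mehler) Gaussian: for all $x,z\in\mathbb R^n$ and $t>0$, $$p_t(x,z)\,e^{-f(z)}=(2\pi v_t)^{-n/2}\exp\Big(-\frac{|z-m_t(x)|^2}{2v_t}\Big),\qquad v_t=2\int_0^t e^{-2ks}\,ds,\quad m_t(x)=x-\Big(\int_0^t e^{-ks}\,ds\Big)\nabla f(x),$$ and the means are contracted by $e^{-kt}$: $m_t(x)-m_t(y)=e^{-kt}(x-y)$. -/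

import Mathlib

open MeasureTheory Filter Topology
open scoped ENNReal ContDiff

noncomputable section

/-- The reference measure `e^{-f} 𝓛ⁿ` on Euclidean space. -/
def weightedMeasure {n : ℕ} (f : EuclideanSpace ℝ (Fin n) → ℝ) :
    Measure (EuclideanSpace ℝ (Fin n)) :=
  volume.withDensity (fun z => ENNReal.ofReal (Real.exp (-f z)))

/-- The weighted Laplacian `Δ_f u = Δ u - ⟨∇ f, ∇ u⟩` of `(ℝⁿ, |·|, e^{-f} 𝓛ⁿ)`. -/
def weightedLaplacian {n : ℕ} (f u : EuclideanSpace ℝ (Fin n) → ℝ)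
    (y : EuclideanSpace ℝ (Fin n)) : ℝ :=
  Laplacian.laplacian u y - inner ℝ (gradient f y) (gradient u y)

/-- `u` is a non-negative fundamental solution of the heat equation `∂ₜ u = Δ_f u` on
`(0, ∞) × ℝⁿ` with source `x`: it is smooth, solves the equation, and `u(t, ·) e^{-f} 𝓛ⁿ`
tends to the Dirac mass at `x` in the sense of distributions as `t → 0+`.
The values of `u` at times `t ≤ 0` are irrelevant. -/
structure IsFundamentalSolution {n : ℕ} (f : EuclideanSpace ℝ (Fin n) → ℝ)
    (x : EuclideanSpace ℝ (Fin n)) (u : ℝ → EuclideanSpace ℝ (Fin n) → ℝ) : Prop where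
  smooth : ContDiffOn ℝ ∞ (fun q : ℝ × EuclideanSpace ℝ (Fin n) => u q.1 q.2)
    (Set.Ioi 0 ×ˢ Set.univ)
  nonneg : ∀ t : ℝ, 0 < t → ∀ y, 0 ≤ u t y
  heat_eq : ∀ t : ℝ, 0 < t → ∀ y, deriv (fun s => u s y) t = weightedLaplacian f (u t) y
  initial : ∀ φ : EuclideanSpace ℝ (Fin n) → ℝ, ContDiff ℝ ∞ φ → HasCompactSupport φ →
    Tendsto (fun t => ∫ y, u t y * φ y ∂(weightedMeasure f)) (𝓝[>] 0) (𝓝 (φ x))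

/-- `p = p_t(x, y)` is the heat kernel of `(ℝⁿ, |·|, e^{-f} 𝓛ⁿ)`: for each source `x` it is the
minimal non-negative fundamental solution (in the variables `t`, `y`). -/
def IsHeatKernel {n : ℕ} (f : EuclideanSpace ℝ (Fin n) → ℝ)
    (p : ℝ → EuclideanSpace ℝ (Fin n) → EuclideanSpace ℝ (Fin n) → ℝ) : Prop :=
  ∀ x, IsFundamentalSolution f x (fun t y => p t x y) ∧
    ∀ u, IsFundamentalSolution f x u → ∀ t : ℝ, 0 < t → ∀ y, p t x y ≤ u t y

/-- The measure `p_t(x, ·) = p_t(x, z) e^{-f(z)} dz`. -/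
def heatKernelMeasure {n : ℕ} (f : EuclideanSpace ℝ (Fin n) → ℝ)
    (p : ℝ → EuclideanSpace ℝ (Fin n) → EuclideanSpace ℝ (Fin n) → ℝ)
    (t : ℝ) (x : EuclideanSpace ℝ (Fin n)) : Measure (EuclideanSpace ℝ (Fin n)) :=
  (weightedMeasure f).withDensity (fun z => ENNReal.ofReal (p t x z))

/-- The `p`-Wasserstein distance, `1 ≤ p ≤ ∞`: the infimum over all couplings `π` of `μ` and `ν`
of the `L^p(π)`-norm of the distance (for `p = ∞` the `π`-essential supremum). -/
def wassersteinDist {X : Type*} [PseudoMetricSpace X] [MeasurableSpace X]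
    (p : ℝ≥0∞) (μ ν : Measure X) : ℝ≥0∞ :=
  ⨅ (π : Measure (X × X)) (_ : π.map Prod.fst = μ ∧ π.map Prod.snd = ν),
    eLpNorm (fun z : X × X => dist z.1 z.2) p π

/-- The mean `x - (∫₀ᵗ e^{-ks} ds) ∇f(x)` at time `t` of the Ornstein–Uhlenbeck process with drift
`-∇f` started at `x`, when `∇²f ≡ k Id`. -/
def ouMean {n : ℕ} (f : EuclideanSpace ℝ (Fin n) → ℝ) (k t : ℝ)
    (x : EuclideanSpace ℝ (Fin n)) : EuclideanSpace ℝ (Fin n) :=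
  x - (∫ s in (0 : ℝ)..t, Real.exp (-(k * s))) • gradient f x

/-- The variance `2 ∫₀ᵗ e^{-2ks} ds` in each direction at time `t` of that process. -/
def ouVariance (k t : ℝ) : ℝ :=
  2 * ∫ s in (0 : ℝ)..t, Real.exp (-(2 * k * s))

end

/-!
Since `∇²f ≡ k Id`, the function `f` is a quadratic polynomial, so the drift `-∇f` is affine and the
candidate for the heat kernel is explicit: the Mehler kernel, a Gaussian density multiplied by
`e^f`. It is the exponential of a quadratic polynomial `G` in the second space variable, so the heat
equation is the identity `∂ₜ G = Δ_f G + |∇G|²` (`hasDerivAt_mehlerKernel`), and it is symmetric in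
its two space variables (`mehlerKernel_comm`).

The main point is minimality (`mehlerKernel_le`). Let `u` be any non-negative fundamental solution
with source `x`; nothing is known about its growth, so it can only be paired with compactly supported
functions. For fixed `y`, the time-reversed kernel `h(s, z) = p_{T+δ-s}(y, z)` solves the backward
equation and tends to `0` at spatial infinity. With `χ` convex, non-decreasing and zero on
`(-∞, 0]`, the truncation `w = χ(N (h - ε))` therefore has compact support and satisfies
`∂ₛ w + Δ_f w ≥ 0`. Hence `s ↦ ∫ u(s) w(s) e^{-f}` is non-decreasing
(`IsFundamentalSolution.le_integral_mul`), and comparing `s → 0` with `s = T` gives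
`χ(N (p_{T+δ}(y, x) - ε)) ≤ ∫ u(T, z) χ(N (p_δ(y, z) - ε)) e^{-f(z)} dz`. As `δ → 0` the support of
the last integrand shrinks to `y` while `p_δ(y, ·) e^{-f}` has mass one, so the right side is at most
`N (u(T, y) + o(1))`; letting `ε → 0` and `N → ∞` yields `p_T(x, y) = p_T(y, x) ≤ u(T, y)`.

The measures `p_t(x, ·)` are then Gaussians with a common covariance, that is, translates of each
other: the translation coupling bounds every `W_q` above by the distance of the means, and the
barycentre bounds it below (`wassersteinDist_isotropicGaussian`).
-/

/-! ### Functions with constant Hessian and the Ornstein–Uhlenbeck mean and variance -/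

/-- The quadratic function `z ↦ c + ⟨b, z⟩ + (k/2) |z|²`. -/
noncomputable def quadraticPotential {n : ℕ} (k : ℝ) (b : EuclideanSpace ℝ (Fin n)) (c : ℝ)
    (z : EuclideanSpace ℝ (Fin n)) : ℝ :=
  c + inner ℝ b z + k / 2 * ‖z‖ ^ 2

lemma hasGradientAt_quadraticPotential {n : ℕ} (k : ℝ) (b : EuclideanSpace ℝ (Fin n)) (c : ℝ)
    (z : EuclideanSpace ℝ (Fin n)) :
    HasGradientAt (quadraticPotential k b c) (b + k • z) z := by
  rw [hasGradientAt_iff_hasFDerivAt]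
  have h1 : HasFDerivAt (fun y : EuclideanSpace ℝ (Fin n) => inner ℝ b y) (innerSL ℝ b) z :=
    (innerSL ℝ b).hasFDerivAt
  have h2 := ((hasStrictFDerivAt_norm_sq z).hasFDerivAt).const_mul (k / 2)
  refine ((h1.const_add c).add h2).congr_fderiv ?_
  ext w
  simp
  ring

lemma contDiff_quadraticPotential {n : ℕ} (k : ℝ) (b : EuclideanSpace ℝ (Fin n)) (c : ℝ) :
    ContDiff ℝ ∞ (quadraticPotential k b c) := by
  unfold quadraticPotential
  exact (contDiff_const.add (contDiff_const.inner ℝ contDiff_id)).add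
    (contDiff_const.mul (contDiff_norm_sq ℝ))

/-- A `C²` function whose Hessian is `k Id` everywhere is a quadratic polynomial with leading part
`(k/2) |z|²`. -/
lemma exists_eq_quadraticPotential {n : ℕ} {k : ℝ} {f : EuclideanSpace ℝ (Fin n) → ℝ}
    (hf : ContDiff ℝ 2 f)
    (hess : ∀ x v w : EuclideanSpace ℝ (Fin n),
      (fderiv ℝ (fderiv ℝ f) x v) w = k * inner ℝ v w) :
    ∃ b c, f = quadraticPotential k b c := by
  have hd : Differentiable ℝ f := hf.differentiable (by norm_num)
  have hd' : Differentiable ℝ (fderiv ℝ f) :=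
    (hf.fderiv_right (m := 1) (by norm_num)).differentiable (by norm_num)
  have key : ∀ z, fderiv ℝ f z = fderiv ℝ f 0 + k • innerSL ℝ z := by
    have hlin : Differentiable ℝ (fun z : EuclideanSpace ℝ (Fin n) => k • innerSL ℝ z) :=
      ((innerSL ℝ (E := EuclideanSpace ℝ (Fin n))).differentiable).const_smul k
    have h0 : ∀ z, fderiv ℝ (fun z => fderiv ℝ f z - k • innerSL ℝ z) z = 0 := by
      intro z
      rw [fderiv_fun_sub (hd' z) (hlin z)]
      ext v w
      have : HasFDerivAt (fun z : EuclideanSpace ℝ (Fin n) => k • innerSL ℝ z)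
          (k • innerSL ℝ (E := EuclideanSpace ℝ (Fin n))) z :=
        ((innerSL ℝ (E := EuclideanSpace ℝ (Fin n))).hasFDerivAt).const_smul k
      rw [this.fderiv]
      simp only [sub_apply, hess, smul_apply, smul_eq_mul, zero_apply]
      exact sub_self _
    intro z
    have := is_const_of_fderiv_eq_zero (hd'.sub hlin) h0 z 0
    simp only [Pi.sub_apply, map_zero, smul_zero, sub_zero] at this
    rw [← this]; abel
  refine ⟨gradient f 0, f 0, ?_⟩
  have hq : ∀ z, HasGradientAt (quadraticPotential k (gradient f 0) (f 0))
    (gradient f 0 + k • z) z := hasGradientAt_quadraticPotential k _ _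
  have h0 : ∀ z, fderiv ℝ (f - quadraticPotential k (gradient f 0) (f 0)) z = 0 := by
    intro z
    rw [fderiv_sub (hd z) (hq z).differentiableAt]
    ext v
    rw [sub_apply, (hq z).fderiv_apply, key]
    simp [inner_add_left, inner_smul_left, inner_gradient_left]
  funext z
  have := is_const_of_fderiv_eq_zero (hd.sub fun z => (hq z).differentiableAt) h0 z 0
  simp [quadraticPotential, sub_eq_zero] at this
  rw [quadraticPotential, inner_gradient_left]; linarith

/-- The integral `∫₀ᵗ e^{-ks} ds`, which is `(1 - e^{-kt}) / k` for `k ≠ 0` and `t` for `k = 0`. -/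
noncomputable def expIntegral (k t : ℝ) : ℝ := ∫ s in (0 : ℝ)..t, Real.exp (-(k * s))

lemma hasDerivAt_expIntegral (k t : ℝ) :
    HasDerivAt (expIntegral k) (Real.exp (-(k * t))) t := by
  have hc : Continuous fun s : ℝ => Real.exp (-(k * s)) := by fun_prop
  exact intervalIntegral.integral_hasDerivAt_right (hc.intervalIntegrable _ _)
    (hc.stronglyMeasurableAtFilter _ _) hc.continuousAt

lemma contDiff_expIntegral (k : ℝ) : ContDiff ℝ ∞ (expIntegral k) := by
  rw [contDiff_infty_iff_deriv]
  refine ⟨fun t => (hasDerivAt_expIntegral k t).differentiableAt, ?_⟩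
  rw [show deriv (expIntegral k) = fun t => Real.exp (-(k * t)) from
    funext fun t => (hasDerivAt_expIntegral k t).deriv]
  fun_prop

@[simp] lemma expIntegral_zero (k : ℝ) : expIntegral k 0 = 0 := by simp [expIntegral]

lemma expIntegral_pos (k : ℝ) {t : ℝ} (ht : 0 < t) : 0 < expIntegral k t :=
  intervalIntegral.intervalIntegral_pos_of_pos
    (Continuous.intervalIntegrable (by fun_prop) _ _) (fun _ => Real.exp_pos _) ht

/-- The identity `k ∫₀ᵗ e^{-ks} ds = 1 - e^{-kt}`. -/
lemma mul_expIntegral (k t : ℝ) : k * expIntegral k t = 1 - Real.exp (-(k * t)) := by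
  have h : ∀ s, HasDerivAt (fun s => k * expIntegral k s + Real.exp (-(k * s))) 0 s := by
    intro s
    have h1 : HasDerivAt (fun s => Real.exp (-(k * s))) (Real.exp (-(k * s)) * (-(k * 1))) s :=
      (((hasDerivAt_id s).const_mul k).neg).exp
    convert! ((hasDerivAt_expIntegral k s).const_mul k).add h1 using 1
    ring
  have := is_const_of_deriv_eq_zero (fun s => (h s).differentiableAt) (fun s => (h s).deriv) t 0
  simp at this
  linarith

lemma ouVariance_eq (k t : ℝ) : ouVariance k t = 2 * expIntegral (2 * k) t := rfl

lemma ouVariance_pos (k : ℝ) {t : ℝ} (ht : 0 < t) : 0 < ouVariance k t :=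
  mul_pos two_pos (expIntegral_pos _ ht)

lemma hasDerivAt_ouVariance (k t : ℝ) :
    HasDerivAt (ouVariance k) (2 * Real.exp (-(k * t)) ^ 2) t := by
  convert! (hasDerivAt_expIntegral (2 * k) t).const_mul 2 using 2
  rw [← Real.exp_nat_mul]; congr 1; push_cast; ring

lemma contDiff_ouVariance (k : ℝ) : ContDiff ℝ ∞ (ouVariance k) :=
  contDiff_const.mul (contDiff_expIntegral (2 * k))

@[simp] lemma ouVariance_zero (k : ℝ) : ouVariance k 0 = 0 := by simp [ouVariance_eq]

lemma mul_ouVariance (k t : ℝ) : k * ouVariance k t = 1 - Real.exp (-(k * t)) ^ 2 := by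
  have h := mul_expIntegral (2 * k) t
  rw [show Real.exp (-(2 * k * t)) = Real.exp (-(k * t)) ^ 2 by
    rw [← Real.exp_nat_mul]; congr 1; push_cast; ring] at h
  rw [ouVariance_eq, ← h]; ring

/-- The factorization `2 ∫₀ᵗ e^{-2ks} ds = (∫₀ᵗ e^{-ks} ds) (1 + e^{-kt})`. -/
lemma ouVariance_eq_mul (k t : ℝ) :
    ouVariance k t = expIntegral k t * (1 + Real.exp (-(k * t))) := by
  have h : ∀ s, HasDerivAt
      (fun s => ouVariance k s - expIntegral k s * (1 + Real.exp (-(k * s)))) 0 s := by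
    intro s
    have h1 : HasDerivAt (fun s => Real.exp (-(k * s))) (Real.exp (-(k * s)) * (-(k * 1))) s :=
      (((hasDerivAt_id s).const_mul k).neg).exp
    convert! (hasDerivAt_ouVariance k s).sub
      ((hasDerivAt_expIntegral k s).mul (h1.const_add 1)) using 1
    linear_combination (-Real.exp (-(k * s))) * mul_expIntegral k s
  have := is_const_of_deriv_eq_zero (fun s => (h s).differentiableAt) (fun s => (h s).deriv) t 0
  simp at this
  linarith

lemma ouMean_quadraticPotential {n : ℕ} (k : ℝ) (b : EuclideanSpace ℝ (Fin n)) (c t : ℝ)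
    (x : EuclideanSpace ℝ (Fin n)) :
    ouMean (quadraticPotential k b c) k t x =
      Real.exp (-(k * t)) • x - expIntegral k t • b := by
  have h := mul_expIntegral k t
  rw [ouMean, (hasGradientAt_quadraticPotential k b c x).gradient,
    show Real.exp (-(k * t)) = 1 - k * expIntegral k t by linarith, ← expIntegral]
  module

/-! ### Isotropic Gaussian densities -/

/-- The density at `z` of the Gaussian measure on `ℝⁿ` with mean `m` and covariance `v Id`. -/
noncomputable def gaussianDensity {n : ℕ} (v : ℝ) (m z : EuclideanSpace ℝ (Fin n)) : ℝ :=
  (2 * Real.pi * v) ^ (-((n : ℝ) / 2)) * Real.exp (-(‖z - m‖ ^ 2 / (2 * v)))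

section GaussianDensity

variable {n : ℕ} {v : ℝ}

lemma gaussianDensity_pos (hv : 0 < v) (m z : EuclideanSpace ℝ (Fin n)) :
    0 < gaussianDensity v m z :=
  mul_pos (Real.rpow_pos_of_pos (by positivity) _) (Real.exp_pos _)

@[fun_prop]
lemma continuous_gaussianDensity (m : EuclideanSpace ℝ (Fin n)) :
    Continuous (gaussianDensity v m) := by
  unfold gaussianDensity; fun_prop

lemma integrable_exp_neg_mul_norm_sq {a : ℝ} (ha : 0 < a) :
    Integrable (fun z : EuclideanSpace ℝ (Fin n) => Real.exp (-a * ‖z‖ ^ 2)) := by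
  by_contra h
  have h1 := GaussianFourier.integral_rexp_neg_mul_sq_norm (V := EuclideanSpace ℝ (Fin n)) ha
  rw [integral_undef h] at h1
  exact (Real.rpow_pos_of_pos (by positivity) _).ne h1

/-- The substitution `z = m + √v w` turns `N(m, v Id)` into the standard Gaussian. -/
lemma gaussianDensity_add_smul (hv : 0 < v) (m w : EuclideanSpace ℝ (Fin n)) :
    gaussianDensity v m (m + √v • w) = (√v ^ n)⁻¹ * gaussianDensity 1 0 w := by
  have h1 : (2 * Real.pi * v) ^ (-((n : ℝ) / 2)) =
      (√v ^ n)⁻¹ * (2 * Real.pi * 1) ^ (-((n : ℝ) / 2)) := by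
    rw [Real.mul_rpow (by positivity) hv.le, mul_one, mul_comm]
    congr 1
    rw [Real.rpow_neg hv.le, Real.sqrt_eq_rpow, ← Real.rpow_mul_natCast hv.le]
    congr 2; ring
  have h2 : ‖m + √v • w - m‖ ^ 2 / (2 * v) = ‖w - 0‖ ^ 2 / (2 * 1) := by
    rw [add_sub_cancel_left, norm_smul, mul_pow, Real.norm_eq_abs, sq_abs, Real.sq_sqrt hv.le,
      sub_zero]
    field_simp
  rw [gaussianDensity, gaussianDensity, h1, h2, mul_assoc]

lemma integral_gaussianDensity_smul {F : Type*} [NormedAddCommGroup F] [NormedSpace ℝ F]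
    (hv : 0 < v) (m : EuclideanSpace ℝ (Fin n)) (φ : EuclideanSpace ℝ (Fin n) → F) :
    ∫ z, gaussianDensity v m z • φ z =
      ∫ w : EuclideanSpace ℝ (Fin n), gaussianDensity 1 0 w • φ (m + √v • w) := by
  have hs : 0 < √v := Real.sqrt_pos.2 hv
  have h1 := Measure.integral_comp_smul (volume : Measure (EuclideanSpace ℝ (Fin n)))
    (fun z => gaussianDensity v m (m + z) • φ (m + z)) (√v)
  rw [integral_add_left_eq_self (fun z => gaussianDensity v m z • φ z) m] at h1
  simp only [gaussianDensity_add_smul hv, mul_smul, integral_smul, finrank_euclideanSpace,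
    Fintype.card_fin] at h1
  rw [abs_of_pos (by positivity)] at h1
  exact (smul_right_injective F (by positivity : (√v ^ n)⁻¹ ≠ 0) h1).symm

lemma integrable_gaussianDensity (hv : 0 < v) (m : EuclideanSpace ℝ (Fin n)) :
    Integrable (gaussianDensity v m) := by
  have h := ((integrable_exp_neg_mul_norm_sq (n := n) (a := (2 * v)⁻¹)
    (by positivity)).comp_sub_right m).const_mul ((2 * Real.pi * v) ^ (-((n : ℝ) / 2)))
  convert h using 3
  unfold gaussianDensity
  congr 2
  field_simp

lemma integral_gaussianDensity (hv : 0 < v) (m : EuclideanSpace ℝ (Fin n)) :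
    ∫ z, gaussianDensity v m z = 1 := by
  have h := integral_gaussianDensity_smul hv m fun _ => (1 : ℝ)
  simp only [smul_eq_mul, mul_one] at h
  have h1 := GaussianFourier.integral_rexp_neg_mul_sq_norm (V := EuclideanSpace ℝ (Fin n))
    (b := (2 : ℝ)⁻¹) (by norm_num)
  rw [h]
  unfold gaussianDensity
  rw [integral_const_mul]
  have h2 : ∀ w : EuclideanSpace ℝ (Fin n),
      Real.exp (-(‖w - 0‖ ^ 2 / (2 * 1))) = Real.exp (-2⁻¹ * ‖w‖ ^ 2) := by
    intro w; rw [sub_zero]; congr 1; ring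
  simp only [h2, h1, finrank_euclideanSpace, Fintype.card_fin]
  rw [Real.rpow_neg (by positivity), show Real.pi / 2⁻¹ = 2 * Real.pi * 1 by ring]
  exact inv_mul_cancel₀ (Real.rpow_pos_of_pos (by positivity) _).ne'

lemma integrable_gaussianDensity_smul_self (hv : 0 < v) (m : EuclideanSpace ℝ (Fin n)) :
    Integrable fun z => gaussianDensity v m z • z := by
  -- It suffices to treat `z - m`, and `|z - m| ≤ 1 + |z - m|²` is absorbed by half the exponent.
  suffices h : Integrable fun z => gaussianDensity v m z • (z - m) by
    have h' := h.add ((integrable_gaussianDensity hv m).smul_const m)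
    refine h'.congr (Eventually.of_forall fun z => ?_)
    simp [smul_sub]
  set C : ℝ := (2 * Real.pi * v) ^ (-((n : ℝ) / 2)) * max 1 (4 * v) with hC
  have hC0 : 0 ≤ (2 * Real.pi * v) ^ (-((n : ℝ) / 2)) := by positivity
  have h := ((integrable_exp_neg_mul_norm_sq (n := n) (a := (4 * v)⁻¹)
    (by positivity)).comp_sub_right m).const_mul C
  refine h.mono' (by fun_prop) (Eventually.of_forall fun z => ?_)
  rw [norm_smul, Real.norm_of_nonneg (gaussianDensity_pos hv m z).le, gaussianDensity, hC,
    mul_assoc (_ ^ _), mul_assoc (_ ^ _)]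
  refine mul_le_mul_of_nonneg_left ?_ hC0
  set r := ‖z - m‖
  have h1 : r ≤ max 1 (4 * v) * Real.exp ((4 * v)⁻¹ * r ^ 2) := by
    have h2 := Real.add_one_le_exp ((4 * v)⁻¹ * r ^ 2)
    have h3 : r ≤ 1 + r ^ 2 := by nlinarith [sq_nonneg (r - 1)]
    have h4 : 1 + r ^ 2 ≤ max 1 (4 * v) * ((4 * v)⁻¹ * r ^ 2 + 1) := by
      have h5 : r ^ 2 = 4 * v * ((4 * v)⁻¹ * r ^ 2) := by field_simp
      have h6 := mul_le_mul_of_nonneg_right (le_max_right 1 (4 * v))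
        (by positivity : 0 ≤ (4 * v)⁻¹ * r ^ 2)
      linarith [le_max_left 1 (4 * v)]
    exact h3.trans (h4.trans (mul_le_mul_of_nonneg_left h2 (by positivity)))
  calc Real.exp (-(r ^ 2 / (2 * v))) * r
      ≤ Real.exp (-(r ^ 2 / (2 * v))) * (max 1 (4 * v) * Real.exp ((4 * v)⁻¹ * r ^ 2)) := by
        gcongr
    _ = max 1 (4 * v) * Real.exp (-(4 * v)⁻¹ * r ^ 2) := by
        rw [mul_left_comm, ← Real.exp_add]; congr 2; field_simp; ring

lemma integral_gaussianDensity_smul_self (hv : 0 < v) (m : EuclideanSpace ℝ (Fin n)) :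
    ∫ z, gaussianDensity v m z • z = m := by
  have hodd : ∫ w : EuclideanSpace ℝ (Fin n), gaussianDensity 1 0 w • w = 0 := by
    have h := integral_neg_eq_self (fun w : EuclideanSpace ℝ (Fin n) => gaussianDensity 1 0 w • w)
      volume
    simp only [smul_neg, integral_neg] at h
    have h2 : ∀ w : EuclideanSpace ℝ (Fin n), gaussianDensity 1 0 (-w) = gaussianDensity 1 0 w := by
      intro w; simp [gaussianDensity]
    simp only [h2] at h
    rw [eq_comm, ← add_eq_zero_iff_eq_neg, ← two_smul ℝ] at h
    exact (smul_eq_zero.1 h).resolve_left two_ne_zero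
  rw [integral_gaussianDensity_smul hv]
  have h1 : ∀ w : EuclideanSpace ℝ (Fin n), gaussianDensity 1 0 w • (m + √v • w) =
      gaussianDensity 1 0 w • m + √v • (gaussianDensity 1 0 w • w) := by
    intro w; module
  simp only [h1]
  rw [integral_add ((integrable_gaussianDensity one_pos 0).smul_const m)
    ((integrable_gaussianDensity_smul_self one_pos 0).fun_smul _), integral_smul, hodd,
    integral_smul_const, integral_gaussianDensity one_pos]
  simp

/-- Gaussians whose means converge to `x` and whose variances tend to `0` converge weakly to the
Dirac mass at `x`. -/
lemma tendsto_integral_gaussianDensity_mul {ι : Type*} {l : Filter ι} [l.IsCountablyGenerated]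
    {v : ι → ℝ} {m : ι → EuclideanSpace ℝ (Fin n)} {x : EuclideanSpace ℝ (Fin n)}
    (hv : Tendsto v l (𝓝 0)) (hv0 : ∀ᶠ t in l, 0 < v t) (hm : Tendsto m l (𝓝 x))
    {φ : EuclideanSpace ℝ (Fin n) → ℝ} (hφ : Continuous φ) {C : ℝ} (hC : ∀ z, |φ z| ≤ C) :
    Tendsto (fun t => ∫ z, gaussianDensity (v t) (m t) z * φ z) l (𝓝 (φ x)) := by
  have h : Tendsto (fun t => ∫ w : EuclideanSpace ℝ (Fin n),
      gaussianDensity 1 0 w * φ (m t + √(v t) • w)) l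
      (𝓝 (∫ w : EuclideanSpace ℝ (Fin n), gaussianDensity 1 0 w * φ x)) := by
    refine tendsto_integral_filter_of_dominated_convergence (fun w => gaussianDensity 1 0 w * C)
      (Eventually.of_forall fun t => ?_) (Eventually.of_forall fun t =>
        Eventually.of_forall fun w => ?_) ((integrable_gaussianDensity one_pos 0).mul_const C)
      (Eventually.of_forall fun w => ?_)
    · exact Continuous.aestronglyMeasurable (by fun_prop)
    · rw [norm_mul, Real.norm_of_nonneg (gaussianDensity_pos one_pos 0 w).le]
      exact mul_le_mul_of_nonneg_left (hC _) (gaussianDensity_pos one_pos 0 w).le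
    · refine ((hφ.tendsto x).comp ?_).const_mul _
      have h1 := hm.add (((Real.continuous_sqrt.tendsto 0).comp hv).smul_const w)
      simpa using h1
  rw [integral_mul_const, integral_gaussianDensity one_pos, one_mul] at h
  refine h.congr' ?_
  filter_upwards [hv0] with t ht
  exact (integral_gaussianDensity_smul ht (m t) φ).symm

end GaussianDensity

/-! ### The weighted Laplacian and the Mehler kernel -/

section WeightedLaplacian

variable {n : ℕ}

/-- The Laplacian as the sum of the second partial derivatives. -/
lemma laplacian_eq_sum_fderiv {u : EuclideanSpace ℝ (Fin n) → ℝ} {z : EuclideanSpace ℝ (Fin n)}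
    (hu : ContDiffAt ℝ 2 u z) :
    Laplacian.laplacian u z = ∑ i, fderiv ℝ (fun y => fderiv ℝ u y
      (EuclideanSpace.basisFun (Fin n) ℝ i)) z (EuclideanSpace.basisFun (Fin n) ℝ i) := by
  rw [InnerProductSpace.laplacian_eq_iteratedFDeriv_orthonormalBasis u
    (EuclideanSpace.basisFun (Fin n) ℝ)]
  refine Finset.sum_congr rfl fun i _ => ?_
  have hd : DifferentiableAt ℝ (fderiv ℝ u) z :=
    (hu.fderiv_right (m := 1) (by norm_num)).differentiableAt (by norm_num)
  rw [iteratedFDeriv_two_apply, fderiv_clm_apply hd (differentiableAt_const _)]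
  simp

/-- The drift term of the weighted Laplacian in coordinates. -/
lemma inner_gradient_eq_sum_fderiv (f u : EuclideanSpace ℝ (Fin n) → ℝ)
    (z : EuclideanSpace ℝ (Fin n)) :
    inner ℝ (gradient f z) (gradient u z) = ∑ i, fderiv ℝ f z (EuclideanSpace.basisFun (Fin n) ℝ i) *
      fderiv ℝ u z (EuclideanSpace.basisFun (Fin n) ℝ i) := by
  rw [← (EuclideanSpace.basisFun (Fin n) ℝ).sum_inner_mul_inner]
  refine Finset.sum_congr rfl fun i _ => ?_
  rw [inner_gradient_left, real_inner_comm, inner_gradient_left]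

lemma laplacian_quadraticPotential (k : ℝ) (b : EuclideanSpace ℝ (Fin n)) (c : ℝ)
    (z : EuclideanSpace ℝ (Fin n)) :
    Laplacian.laplacian (quadraticPotential k b c) z = n * k := by
  rw [laplacian_eq_sum_fderiv ((contDiff_quadraticPotential k b c).of_le (by norm_cast)).contDiffAt]
  have h : ∀ i, fderiv ℝ (fun y => fderiv ℝ (quadraticPotential k b c) y
      (EuclideanSpace.basisFun (Fin n) ℝ i)) z (EuclideanSpace.basisFun (Fin n) ℝ i) = k := by
    intro i
    set w := EuclideanSpace.basisFun (Fin n) ℝ i with hw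
    have h1 : (fun y => fderiv ℝ (quadraticPotential k b c) y w) =
        fun y => inner ℝ b w + k * innerSL ℝ w y := by
      funext y
      rw [(hasGradientAt_quadraticPotential k b c y).fderiv_apply, inner_add_left,
        real_inner_smul_left, real_inner_comm w y]
      rfl
    have h2 : HasFDerivAt (fun y => inner ℝ b w + k * innerSL ℝ w y) (k • innerSL ℝ w) z :=
      (((innerSL ℝ w).hasFDerivAt).const_mul k).const_add _
    rw [h1, h2.fderiv]
    change k * inner ℝ w w = k
    rw [real_inner_self_eq_norm_sq, hw, OrthonormalBasis.norm_eq_one]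
    ring
  rw [Finset.sum_congr rfl fun i _ => h i]
  simp

/-- The chain rule `Δ_f (F ∘ h) = F'(h) Δ_f h + F''(h) |∇h|²`. -/
lemma weightedLaplacian_comp (f : EuclideanSpace ℝ (Fin n) → ℝ)
    {h : EuclideanSpace ℝ (Fin n) → ℝ} {F F' F'' : ℝ → ℝ} {z : EuclideanSpace ℝ (Fin n)}
    (hh : ContDiff ℝ 2 h) (hF : ∀ r, HasDerivAt F (F' r) r) (hF' : ∀ r, HasDerivAt F' (F'' r) r)
    (hF2 : ContDiff ℝ 2 F) :
    weightedLaplacian f (fun y => F (h y)) z =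
      F' (h z) * weightedLaplacian f h z + F'' (h z) * ‖gradient h z‖ ^ 2 := by
  have hd : Differentiable ℝ h := hh.differentiable (by norm_num)
  have hd' : Differentiable ℝ (fderiv ℝ h) :=
    (hh.fderiv_right (m := 1) (by norm_num)).differentiable (by norm_num)
  have h1 : ∀ y w, fderiv ℝ (fun y => F (h y)) y w = F' (h y) * fderiv ℝ h y w := by
    intro y w
    have := (hF (h y)).comp_hasFDerivAt y (hd y).hasFDerivAt
    rw [show (fun y => F (h y)) = F ∘ h from rfl, this.fderiv]
    simp
  have hFh : ContDiff ℝ 2 fun y => F (h y) := hF2.comp hh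
  rw [weightedLaplacian, weightedLaplacian, laplacian_eq_sum_fderiv hFh.contDiffAt,
    laplacian_eq_sum_fderiv hh.contDiffAt, inner_gradient_eq_sum_fderiv,
    inner_gradient_eq_sum_fderiv, ← real_inner_self_eq_norm_sq, inner_gradient_eq_sum_fderiv,
    ← Finset.sum_sub_distrib, ← Finset.sum_sub_distrib, Finset.mul_sum, Finset.mul_sum,
    ← Finset.sum_add_distrib]
  refine Finset.sum_congr rfl fun i _ => ?_
  set w := EuclideanSpace.basisFun (Fin n) ℝ i
  have h2 : DifferentiableAt ℝ (fun y => fderiv ℝ h y w) z :=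
    (hd' z).clm_apply (differentiableAt_const w)
  have h3 : fderiv ℝ (fun y => fderiv ℝ (fun y => F (h y)) y w) z w =
      F' (h z) * fderiv ℝ (fun y => fderiv ℝ h y w) z w +
        F'' (h z) * (fderiv ℝ h z w * fderiv ℝ h z w) := by
    simp only [h1]
    have h4 : HasFDerivAt (fun y => F' (h y)) (F'' (h z) • fderiv ℝ h z) z :=
      (hF' (h z)).comp_hasFDerivAt z (hd z).hasFDerivAt
    rw [(h4.fun_mul h2.hasFDerivAt).fderiv]
    simp
    ring
  rw [h1, h3]
  ring

end WeightedLaplacian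

section MehlerKernel

variable {n : ℕ}

/-- The Mehler kernel: the density with respect to `e^{-f} 𝓛ⁿ` of the Gaussian with mean
`ouMean f k t x` and variance `ouVariance k t`, for `f = quadraticPotential k b c`. -/
noncomputable def mehlerKernel (k : ℝ) (b : EuclideanSpace ℝ (Fin n)) (c t : ℝ)
    (x z : EuclideanSpace ℝ (Fin n)) : ℝ :=
  Real.exp (quadraticPotential k b c z) *
    gaussianDensity (ouVariance k t) (ouMean (quadraticPotential k b c) k t x) z

variable (k : ℝ) (b : EuclideanSpace ℝ (Fin n)) (c : ℝ)

lemma mehlerKernel_pos {t : ℝ} (ht : 0 < t) (x z : EuclideanSpace ℝ (Fin n)) :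
    0 < mehlerKernel k b c t x z :=
  mul_pos (Real.exp_pos _) (gaussianDensity_pos (ouVariance_pos k ht) _ _)

lemma mehlerKernel_mul_exp_neg (t : ℝ) (x z : EuclideanSpace ℝ (Fin n)) :
    mehlerKernel k b c t x z * Real.exp (-quadraticPotential k b c z) =
      gaussianDensity (ouVariance k t) (ouMean (quadraticPotential k b c) k t x) z := by
  rw [mehlerKernel, mul_right_comm, ← Real.exp_add, add_neg_cancel, Real.exp_zero, one_mul]

/-- The Mehler kernel is the exponential of a quadratic polynomial in its second variable. -/
lemma mehlerKernel_eq_exp {t : ℝ} (ht : 0 < t) (x z : EuclideanSpace ℝ (Fin n)) :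
    mehlerKernel k b c t x z = Real.exp (quadraticPotential
      (-(Real.exp (-(k * t)) ^ 2 / ouVariance k t))
      ((Real.exp (-(k * t)) / ouVariance k t) • (x + expIntegral k t • b))
      (quadraticPotential k b c x - n / 2 * Real.log (2 * Real.pi * ouVariance k t)
        - ‖x + expIntegral k t • b‖ ^ 2 / (2 * ouVariance k t)) z) := by
  have hv := ouVariance_pos k ht
  rw [mehlerKernel, gaussianDensity, Real.rpow_def_of_pos (by positivity), ← Real.exp_add,
    ← Real.exp_add, ouMean_quadraticPotential]
  congr 1
  simp only [quadraticPotential]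
  have h1 := mul_expIntegral k t
  have h2 := mul_ouVariance k t
  have h3 := ouVariance_eq_mul k t
  set e := Real.exp (-(k * t))
  set a := expIntegral k t
  set v := ouVariance k t
  have e1 : ‖z - (e • x - a • b)‖ ^ 2 = ‖z‖ ^ 2 + e ^ 2 * ‖x‖ ^ 2 + a ^ 2 * ‖b‖ ^ 2
      - 2 * e * inner ℝ x z + 2 * a * inner ℝ b z - 2 * e * a * inner ℝ b x := by
    simp only [← real_inner_self_eq_norm_sq, inner_sub_left, inner_sub_right,
      real_inner_smul_left, real_inner_smul_right, real_inner_comm x z, real_inner_comm b z,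
      real_inner_comm b x]
    ring
  have e2 : ‖x + a • b‖ ^ 2 = ‖x‖ ^ 2 + a ^ 2 * ‖b‖ ^ 2 + 2 * a * inner ℝ b x := by
    simp only [← real_inner_self_eq_norm_sq, inner_add_left, inner_add_right,
      real_inner_smul_left, real_inner_smul_right, real_inner_comm b x]
    ring
  rw [e1, e2, real_inner_smul_left, inner_add_left, real_inner_smul_left]
  field_simp
  linear_combination (‖z‖ ^ 2 - ‖x‖ ^ 2) * h2 + 2 * (inner ℝ b z - inner ℝ b x) * h3

/-- The Mehler kernel is symmetric in its two space variables. -/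
lemma mehlerKernel_comm {t : ℝ} (ht : 0 < t) (x z : EuclideanSpace ℝ (Fin n)) :
    mehlerKernel k b c t x z = mehlerKernel k b c t z x := by
  have hv := ouVariance_pos k ht
  rw [mehlerKernel_eq_exp k b c ht, mehlerKernel, gaussianDensity,
    Real.rpow_def_of_pos (by positivity), ← Real.exp_add,
    ← Real.exp_add, ouMean_quadraticPotential]
  congr 1
  set e := Real.exp (-(k * t))
  set a := expIntegral k t
  set v := ouVariance k t
  have e1 : ‖x - (e • z - a • b)‖ ^ 2 = ‖x + a • b‖ ^ 2 + e ^ 2 * ‖z‖ ^ 2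
      - 2 * e * inner ℝ (x + a • b) z := by
    rw [show x - (e • z - a • b) = (x + a • b) - e • z by abel, norm_sub_sq_real, norm_smul,
      real_inner_smul_right, mul_pow, Real.norm_eq_abs, sq_abs]
    ring
  rw [e1, quadraticPotential, real_inner_smul_left]
  field_simp
  ring

/-- Joint smoothness of the Mehler kernel in time and the second space variable. -/
lemma contDiffOn_mehlerKernel (x : EuclideanSpace ℝ (Fin n)) :
    ContDiffOn ℝ ∞ (fun q : ℝ × EuclideanSpace ℝ (Fin n) => mehlerKernel k b c q.1 x q.2)
      (Set.Ioi 0 ×ˢ Set.univ) := by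
  have hv : ContDiffOn ℝ ∞ (fun q : ℝ × EuclideanSpace ℝ (Fin n) => ouVariance k q.1)
      (Set.Ioi 0 ×ˢ Set.univ) := ((contDiff_ouVariance k).comp contDiff_fst).contDiffOn
  have ha : ContDiffOn ℝ ∞ (fun q : ℝ × EuclideanSpace ℝ (Fin n) => expIntegral k q.1)
      (Set.Ioi 0 ×ˢ Set.univ) := ((contDiff_expIntegral k).comp contDiff_fst).contDiffOn
  have he : ContDiffOn ℝ ∞ (fun q : ℝ × EuclideanSpace ℝ (Fin n) => Real.exp (-(k * q.1)))
      (Set.Ioi 0 ×ˢ Set.univ) := by fun_prop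
  have hv0 : ∀ q ∈ (Set.Ioi (0 : ℝ) ×ˢ Set.univ : Set (ℝ × EuclideanSpace ℝ (Fin n))),
      ouVariance k q.1 ≠ 0 := fun q hq => (ouVariance_pos k hq.1).ne'
  have hf := contDiff_quadraticPotential k b c
  have hm : ContDiffOn ℝ ∞ (fun q : ℝ × EuclideanSpace ℝ (Fin n) =>
      ‖q.2 - (Real.exp (-(k * q.1)) • x - expIntegral k q.1 • b)‖ ^ 2) (Set.Ioi 0 ×ˢ Set.univ) :=
    (contDiffOn_snd.sub ((he.smul contDiffOn_const).sub (ha.smul contDiffOn_const))).norm_sq ℝ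
  have hG : ContDiffOn ℝ ∞ (fun q : ℝ × EuclideanSpace ℝ (Fin n) =>
      quadraticPotential k b c q.2 + (Real.log (2 * Real.pi * ouVariance k q.1) * (-((n : ℝ) / 2))
        + -(‖q.2 - (Real.exp (-(k * q.1)) • x - expIntegral k q.1 • b)‖ ^ 2 /
          (2 * ouVariance k q.1)))) (Set.Ioi 0 ×ˢ Set.univ) := by
    refine (hf.comp_contDiffOn contDiffOn_snd).add ((ContDiffOn.mul (ContDiffOn.log
      (contDiffOn_const.mul hv) fun q hq => ?_) contDiffOn_const).add
      (hm.div (contDiffOn_const.mul hv) fun q hq => ?_).neg)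
    · exact mul_ne_zero (by positivity) (hv0 q hq)
    · exact mul_ne_zero two_ne_zero (hv0 q hq)
  refine hG.exp.congr fun q hq => ?_
  have := ouVariance_pos k hq.1
  rw [mehlerKernel, gaussianDensity, Real.rpow_def_of_pos (by positivity), ← Real.exp_add,
    ← Real.exp_add, ouMean_quadraticPotential]

/-- The Mehler kernel solves the heat equation: writing it as `e^G` with `G` a quadratic polynomial
in space, this is the identity `∂ₜ G = Δ_f G + |∇G|²`. -/
lemma hasDerivAt_mehlerKernel {t : ℝ} (ht : 0 < t) (x z : EuclideanSpace ℝ (Fin n)) :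
    HasDerivAt (fun s => mehlerKernel k b c s x z)
      (weightedLaplacian (quadraticPotential k b c) (mehlerKernel k b c t x) z) t := by
  have hv := ouVariance_pos k ht
  have hspace : weightedLaplacian (quadraticPotential k b c) (mehlerKernel k b c t x) z =
      mehlerKernel k b c t x z *
        (-(n * Real.exp (-(k * t)) ^ 2 / ouVariance k t)
          - Real.exp (-(k * t)) / ouVariance k t * inner ℝ (b + k • z)
            (x + expIntegral k t • b - Real.exp (-(k * t)) • z)
          + (Real.exp (-(k * t)) / ouVariance k t) ^ 2 *
            ‖x + expIntegral k t • b - Real.exp (-(k * t)) • z‖ ^ 2) := by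
    rw [show mehlerKernel k b c t x = fun y => Real.exp (quadraticPotential
      (-(Real.exp (-(k * t)) ^ 2 / ouVariance k t))
      ((Real.exp (-(k * t)) / ouVariance k t) • (x + expIntegral k t • b))
      (quadraticPotential k b c x - n / 2 * Real.log (2 * Real.pi * ouVariance k t)
        - ‖x + expIntegral k t • b‖ ^ 2 / (2 * ouVariance k t)) y) from
      funext (mehlerKernel_eq_exp k b c ht x)]
    rw [weightedLaplacian_comp _ ((contDiff_quadraticPotential _ _ _).of_le (by norm_cast))
      Real.hasDerivAt_exp Real.hasDerivAt_exp Real.contDiff_exp, weightedLaplacian,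
      laplacian_quadraticPotential, (hasGradientAt_quadraticPotential _ _ _ z).gradient,
      (hasGradientAt_quadraticPotential _ _ _ z).gradient]
    rw [show (Real.exp (-(k * t)) / ouVariance k t) • (x + expIntegral k t • b) +
      -(Real.exp (-(k * t)) ^ 2 / ouVariance k t) • z = (Real.exp (-(k * t)) / ouVariance k t) •
        (x + expIntegral k t • b - Real.exp (-(k * t)) • z) by
        rw [smul_sub, smul_smul, sub_eq_add_neg, ← neg_smul]; congr 2; ring]
    rw [norm_smul, mul_pow, Real.norm_eq_abs, sq_abs, real_inner_smul_right]
    ring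
  have htime : HasDerivAt (fun s => quadraticPotential k b c x
      + (Real.log (2 * Real.pi * ouVariance k s) * (-((n : ℝ) / 2))
        + -(‖x + expIntegral k s • b - Real.exp (-(k * s)) • z‖ ^ 2 / (2 * ouVariance k s))))
      (-(n * Real.exp (-(k * t)) ^ 2 / ouVariance k t)
          - Real.exp (-(k * t)) / ouVariance k t * inner ℝ (b + k • z)
            (x + expIntegral k t • b - Real.exp (-(k * t)) • z)
          + (Real.exp (-(k * t)) / ouVariance k t) ^ 2 *
            ‖x + expIntegral k t • b - Real.exp (-(k * t)) • z‖ ^ 2) t := by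
    have hV := hasDerivAt_ouVariance k t
    have h1 : HasDerivAt (fun s => Real.exp (-(k * s))) (Real.exp (-(k * t)) * (-(k * 1))) t :=
      (((hasDerivAt_id t).const_mul k).neg).exp
    have h2 := ((((hasDerivAt_expIntegral k t).smul_const b).const_add x).sub
      (h1.smul_const z)).norm_sq
    have h3 := (hV.const_mul (2 * Real.pi)).log (by positivity)
    convert! ((h3.mul_const (-((n : ℝ) / 2))).add
      ((h2.div (hV.const_mul 2) (by positivity)).neg)).const_add
        (quadraticPotential k b c x) using 1
    rw [show Real.exp (-(k * t)) • b - (Real.exp (-(k * t)) * -(k * 1)) • z =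
      Real.exp (-(k * t)) • (b + k • z) by module, real_inner_smul_right, real_inner_comm]
    simp only [Pi.sub_apply]
    field_simp
    ring
  rw [hspace]
  have hexp : ∀ s : ℝ, 0 < s → mehlerKernel k b c s x z = Real.exp (quadraticPotential k b c x
      + (Real.log (2 * Real.pi * ouVariance k s) * (-((n : ℝ) / 2))
        + -(‖x + expIntegral k s • b - Real.exp (-(k * s)) • z‖ ^ 2 / (2 * ouVariance k s)))) := by
    intro s hs
    have := ouVariance_pos k hs
    rw [mehlerKernel_comm k b c hs, mehlerKernel, gaussianDensity,
      Real.rpow_def_of_pos (by positivity), ← Real.exp_add, ← Real.exp_add,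
      ouMean_quadraticPotential, ← sub_add, sub_add_eq_add_sub]
  have h := htime.exp
  rw [← hexp t ht] at h
  refine h.congr_of_eventuallyEq ?_
  filter_upwards [lt_mem_nhds ht] with s hs using hexp s hs

end MehlerKernel

/-! ### The initial condition and Wasserstein distances of Gaussians -/

section WeightedMeasure

variable {n : ℕ}

lemma integral_weightedMeasure {f : EuclideanSpace ℝ (Fin n) → ℝ} (hf : Continuous f)
    (g : EuclideanSpace ℝ (Fin n) → ℝ) :
    ∫ z, g z ∂(weightedMeasure f) = ∫ z, g z * Real.exp (-f z) := by
  rw [weightedMeasure, integral_withDensity_eq_integral_toReal_smul (by fun_prop) (by simp)]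
  refine integral_congr_ae (Eventually.of_forall fun z => ?_)
  simp [ENNReal.toReal_ofReal (Real.exp_pos _).le, mul_comm]

/-- The Mehler kernel is a non-negative fundamental solution. -/
lemma isFundamentalSolution_mehlerKernel (k : ℝ) (b : EuclideanSpace ℝ (Fin n)) (c : ℝ)
    (x : EuclideanSpace ℝ (Fin n)) :
    IsFundamentalSolution (quadraticPotential k b c) x
      (fun t z => mehlerKernel k b c t x z) where
  smooth := contDiffOn_mehlerKernel k b c x
  nonneg t ht y := (mehlerKernel_pos k b c ht x y).le
  heat_eq t ht y := (hasDerivAt_mehlerKernel k b c ht x y).deriv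
  initial φ hφ hφc := by
    obtain ⟨C, hC⟩ := hφc.exists_bound_of_continuous hφ.continuous
    have hv : Tendsto (ouVariance k) (𝓝[>] 0) (𝓝 0) := by
      have := (contDiff_ouVariance k).continuous.tendsto 0
      rw [ouVariance_zero] at this
      exact this.mono_left nhdsWithin_le_nhds
    have hm : Tendsto (fun t => ouMean (quadraticPotential k b c) k t x) (𝓝[>] 0) (𝓝 x) := by
      simp only [ouMean_quadraticPotential]
      have ha := (contDiff_expIntegral k).continuous
      have : Continuous fun t => Real.exp (-(k * t)) • x - expIntegral k t • b := by fun_prop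
      have := this.tendsto 0
      simp only [mul_zero, neg_zero, Real.exp_zero, one_smul, expIntegral_zero, zero_smul,
        sub_zero] at this
      exact this.mono_left nhdsWithin_le_nhds
    have h := tendsto_integral_gaussianDensity_mul hv
      (eventually_nhdsWithin_of_forall fun t ht => ouVariance_pos k ht) hm hφ.continuous hC
    refine h.congr fun t => ?_
    rw [integral_weightedMeasure (contDiff_quadraticPotential k b c).continuous]
    refine integral_congr_ae (Eventually.of_forall fun z => ?_)
    simp only
    rw [mul_right_comm, mehlerKernel_mul_exp_neg]

end WeightedMeasure

section Wasserstein

variable {n : ℕ} {v : ℝ}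

/-- The Gaussian measure on `ℝⁿ` with mean `m` and covariance `v Id`. -/
noncomputable def isotropicGaussian (v : ℝ) (m : EuclideanSpace ℝ (Fin n)) :
    Measure (EuclideanSpace ℝ (Fin n)) :=
  volume.withDensity fun z => ENNReal.ofReal (gaussianDensity v m z)

lemma isProbabilityMeasure_isotropicGaussian (hv : 0 < v) (m : EuclideanSpace ℝ (Fin n)) :
    IsProbabilityMeasure (isotropicGaussian v m) := by
  constructor
  rw [isotropicGaussian, withDensity_apply _ MeasurableSet.univ, Measure.restrict_univ,
    ← ofReal_integral_eq_lintegral_ofReal (integrable_gaussianDensity hv m)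
      (Eventually.of_forall fun z => (gaussianDensity_pos hv m z).le),
    integral_gaussianDensity hv, ENNReal.ofReal_one]

lemma map_add_right_isotropicGaussian (m a : EuclideanSpace ℝ (Fin n)) :
    (isotropicGaussian v m).map (· + a) = isotropicGaussian v (m + a) := by
  have hmeas : ∀ m : EuclideanSpace ℝ (Fin n), Measurable fun z =>
    ENNReal.ofReal (gaussianDensity v m z) := fun m => by fun_prop
  ext s hs
  rw [Measure.map_apply (by fun_prop) hs, isotropicGaussian, isotropicGaussian,
    withDensity_apply _ hs, withDensity_apply _ (measurable_add_const a hs),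
    ← lintegral_indicator hs, ← lintegral_indicator (measurable_add_const a hs),
    ← lintegral_add_right_eq_self
      (s.indicator fun z => ENNReal.ofReal (gaussianDensity v (m + a) z)) a]
  refine lintegral_congr fun z => ?_
  simp [Set.indicator, gaussianDensity]
  rfl

lemma integrable_id_isotropicGaussian (hv : 0 < v) (m : EuclideanSpace ℝ (Fin n)) :
    Integrable (fun z => z) (isotropicGaussian v m) := by
  rw [isotropicGaussian, integrable_withDensity_iff_integrable_smul' (by fun_prop) (by simp)]
  refine (integrable_gaussianDensity_smul_self hv m).congr (Eventually.of_forall fun z => ?_)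
  simp [ENNReal.toReal_ofReal (gaussianDensity_pos hv m z).le]

lemma integral_id_isotropicGaussian (hv : 0 < v) (m : EuclideanSpace ℝ (Fin n)) :
    ∫ z, z ∂(isotropicGaussian v m) = m := by
  rw [isotropicGaussian, integral_withDensity_eq_integral_toReal_smul (by fun_prop) (by simp)]
  simp only [ENNReal.toReal_ofReal (gaussianDensity_pos hv m _).le]
  exact integral_gaussianDensity_smul_self hv m

/-- The distance of the means is a lower bound for every `W_q`, `q ≥ 1`. -/
lemma enorm_integral_sub_le_wassersteinDist {μ ν : Measure (EuclideanSpace ℝ (Fin n))}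
    [IsProbabilityMeasure μ] (hμ : Integrable (fun z => z) μ)
    (hν : Integrable (fun z => z) ν) {q : ℝ≥0∞} (hq : 1 ≤ q) :
    ‖∫ z, z ∂μ - ∫ z, z ∂ν‖ₑ ≤ wassersteinDist q μ ν := by
  refine le_iInf₂ fun π hπ => ?_
  obtain ⟨h1, h2⟩ := hπ
  have : IsProbabilityMeasure π := by
    constructor
    rw [← Set.preimage_univ (f := Prod.fst), ← Measure.map_apply measurable_fst MeasurableSet.univ,
      h1, measure_univ]
  have i1 : Integrable (fun z : EuclideanSpace ℝ (Fin n) × EuclideanSpace ℝ (Fin n) => z.1) π := by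
    rw [← h1] at hμ; exact hμ.comp_measurable measurable_fst
  have i2 : Integrable (fun z : EuclideanSpace ℝ (Fin n) × EuclideanSpace ℝ (Fin n) => z.2) π := by
    rw [← h2] at hν; exact hν.comp_measurable measurable_snd
  have e1 : ∫ z, z ∂μ = ∫ z, z.1 ∂π := by
    rw [← h1, integral_map measurable_fst.aemeasurable (by fun_prop)]
  have e2 : ∫ z, z ∂ν = ∫ z, z.2 ∂π := by
    rw [← h2, integral_map measurable_snd.aemeasurable (by fun_prop)]
  rw [e1, e2, ← integral_sub i1 i2]
  calc ‖∫ z, (z.1 - z.2) ∂π‖ₑ ≤ ∫⁻ z, ‖z.1 - z.2‖ₑ ∂π := enorm_integral_le_lintegral_enorm _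
    _ = eLpNorm (fun z : EuclideanSpace ℝ (Fin n) × EuclideanSpace ℝ (Fin n) =>
          dist z.1 z.2) 1 π := by
        rw [eLpNorm_one_eq_lintegral_enorm]
        refine lintegral_congr fun z => ?_
        rw [dist_eq_norm, enorm_norm]
    _ ≤ _ := eLpNorm_le_eLpNorm_of_exponent_le hq (by fun_prop)

/-- Pushing `μ` forward by a translation moves it by at most the length of the translation. -/
lemma wassersteinDist_map_add_right_le (μ : Measure (EuclideanSpace ℝ (Fin n)))
    [IsProbabilityMeasure μ] (a : EuclideanSpace ℝ (Fin n)) {q : ℝ≥0∞} (hq : 1 ≤ q) :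
    wassersteinDist q μ (μ.map (· + a)) ≤ ‖a‖ₑ := by
  have hmeas : Measurable fun z : EuclideanSpace ℝ (Fin n) => (z, z + a) := by fun_prop
  have h1 : (μ.map fun z => (z, z + a)).map Prod.fst = μ := by
    rw [Measure.map_map measurable_fst hmeas]; exact Measure.map_id
  have h2 : (μ.map fun z => (z, z + a)).map Prod.snd = μ.map (· + a) := by
    rw [Measure.map_map measurable_snd hmeas]; rfl
  refine (iInf₂_le (μ.map fun z => (z, z + a)) ⟨h1, h2⟩).trans ?_
  rw [eLpNorm_map_measure (by fun_prop) hmeas.aemeasurable]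
  have : (fun z : EuclideanSpace ℝ (Fin n) × EuclideanSpace ℝ (Fin n) => dist z.1 z.2) ∘
      (fun z => (z, z + a)) = fun _ => ‖a‖ := by
    funext z; simp
  rw [this, eLpNorm_const _ (one_pos.trans_le hq).ne' (NeZero.ne μ), measure_univ,
    ENNReal.one_rpow, mul_one, enorm_norm]

lemma wassersteinDist_isotropicGaussian (hv : 0 < v) (m₁ m₂ : EuclideanSpace ℝ (Fin n))
    {q : ℝ≥0∞} (hq : 1 ≤ q) :
    wassersteinDist q (isotropicGaussian v m₁) (isotropicGaussian v m₂) = ‖m₁ - m₂‖ₑ := by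
  have := isProbabilityMeasure_isotropicGaussian hv m₁
  refine le_antisymm ?_ ?_
  · have h := wassersteinDist_map_add_right_le (isotropicGaussian v m₁) (m₂ - m₁) hq
    rwa [map_add_right_isotropicGaussian, add_sub_cancel, ← enorm_neg, neg_sub] at h
  · have h := enorm_integral_sub_le_wassersteinDist (integrable_id_isotropicGaussian hv m₁)
      (integrable_id_isotropicGaussian hv m₂) hq
    rwa [integral_id_isotropicGaussian hv, integral_id_isotropicGaussian hv] at h

lemma heatKernelMeasure_eq_isotropicGaussian {f : EuclideanSpace ℝ (Fin n) → ℝ}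
    (hf : Continuous f)
    {p : ℝ → EuclideanSpace ℝ (Fin n) → EuclideanSpace ℝ (Fin n) → ℝ} {t : ℝ}
    {x m : EuclideanSpace ℝ (Fin n)}
    (hp : ∀ z, p t x z * Real.exp (-f z) = gaussianDensity v m z) :
    heatKernelMeasure f p t x = isotropicGaussian v m := by
  have hp' : p t x = fun z => gaussianDensity v m z * Real.exp (f z) := by
    funext z; rw [← hp, mul_assoc, ← Real.exp_add]; simp
  rw [heatKernelMeasure, weightedMeasure, isotropicGaussian,
    ← withDensity_mul _ (by fun_prop) (by rw [hp']; fun_prop)]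
  congr 1
  funext z
  rw [Pi.mul_apply, ← ENNReal.ofReal_mul (Real.exp_pos _).le, mul_comm, hp]

end Wasserstein

/-! ### Convex truncation, integration by parts, differentiation under the integral -/

section ConvexCutoff

/-- A smooth convex substitute for the positive part: `r e^{-1/r}` for `r > 0`, and `0` for
`r ≤ 0`. -/
noncomputable def convexCutoff (r : ℝ) : ℝ := r * expNegInvGlue r

lemma contDiff_convexCutoff : ContDiff ℝ ∞ convexCutoff := contDiff_id.mul expNegInvGlue.contDiff

lemma convexCutoff_of_nonpos {r : ℝ} (hr : r ≤ 0) : convexCutoff r = 0 := by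
  rw [convexCutoff, expNegInvGlue.zero_of_nonpos hr, mul_zero]

lemma convexCutoff_le {r : ℝ} (hr : 0 ≤ r) : convexCutoff r ≤ r := by
  refine mul_le_of_le_one_right hr ?_
  rcases hr.eq_or_lt with rfl | hr
  · simp
  · rw [expNegInvGlue, if_neg hr.not_ge]
    exact Real.exp_le_one_iff.2 (neg_nonpos.2 (inv_nonneg.2 hr.le))

lemma sub_one_le_convexCutoff (r : ℝ) : r - 1 ≤ convexCutoff r := by
  rcases le_or_gt r 0 with hr | hr
  · rw [convexCutoff_of_nonpos hr]; linarith
  · rw [convexCutoff, expNegInvGlue, if_neg hr.not_ge]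
    have h := mul_le_mul_of_nonneg_left (Real.add_one_le_exp (-r⁻¹)) hr.le
    have h' : r * (-r⁻¹ + 1) = r - 1 := by field_simp; ring
    linarith

lemma hasDerivAt_convexCutoff (r : ℝ) :
    HasDerivAt convexCutoff ((1 + r⁻¹) * expNegInvGlue r) r := by
  have h1 := expNegInvGlue.hasDerivAt_polynomial_eval_inv_mul 1 r
  simp only [Polynomial.eval_one, one_mul, Polynomial.derivative_one, sub_zero, mul_one,
    Polynomial.eval_pow, Polynomial.eval_X] at h1
  convert! (hasDerivAt_id r).mul h1 using 1
  rcases eq_or_ne r 0 with rfl | hr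
  · simp
  · simp only [id]; field_simp

lemma hasDerivAt_deriv_convexCutoff (r : ℝ) :
    HasDerivAt (fun r => (1 + r⁻¹) * expNegInvGlue r) (r⁻¹ ^ 3 * expNegInvGlue r) r := by
  have h := expNegInvGlue.hasDerivAt_polynomial_eval_inv_mul (1 + Polynomial.X) r
  simpa [pow_succ, mul_assoc] using h

lemma deriv_convexCutoff_nonneg (r : ℝ) : 0 ≤ (1 + r⁻¹) * expNegInvGlue r := by
  rcases le_or_gt r 0 with hr | hr
  · rw [expNegInvGlue.zero_of_nonpos hr, mul_zero]
  · exact mul_nonneg (by positivity) (expNegInvGlue.nonneg r)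

lemma deriv_deriv_convexCutoff_nonneg (r : ℝ) : 0 ≤ r⁻¹ ^ 3 * expNegInvGlue r := by
  rcases le_or_gt r 0 with hr | hr
  · rw [expNegInvGlue.zero_of_nonpos hr, mul_zero]
  · exact mul_nonneg (by positivity) (expNegInvGlue.nonneg r)

end ConvexCutoff

section IntegrationByParts

variable {n : ℕ}

lemma integral_mul_fderiv_eq_neg_of_hasCompactSupport {P Q : EuclideanSpace ℝ (Fin n) → ℝ}
    (hP : ContDiff ℝ 1 P) (hQ : ContDiff ℝ 1 Q) (hc : HasCompactSupport Q)
    (v : EuclideanSpace ℝ (Fin n)) :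
    ∫ z, P z * fderiv ℝ Q z v = -∫ z, fderiv ℝ P z v * Q z := by
  have hP' : Continuous fun z => fderiv ℝ P z v :=
    (hP.continuous_fderiv (by norm_num)).clm_apply continuous_const
  have hQ' : Continuous fun z => fderiv ℝ Q z v :=
    (hQ.continuous_fderiv (by norm_num)).clm_apply continuous_const
  refine integral_mul_fderiv_eq_neg_fderiv_mul_of_integrable
    ((hP'.mul hQ.continuous).integrable_of_hasCompactSupport hc.mul_left)
    ((hP.continuous.mul hQ').integrable_of_hasCompactSupport (hc.fderiv_apply ℝ v).mul_left)
    ((hP.continuous.mul hQ.continuous).integrable_of_hasCompactSupport hc.mul_left)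
    (fun z _ => hP.differentiable (by norm_num) z) fun z _ => hQ.differentiable (by norm_num) z

/-- Multiplying `Δ_f u` by the weight `e^{-f}` puts it in divergence form. -/
lemma weightedLaplacian_mul_exp_neg {f u : EuclideanSpace ℝ (Fin n) → ℝ} (hf : ContDiff ℝ ∞ f)
    (hu : ContDiff ℝ ∞ u) (z : EuclideanSpace ℝ (Fin n)) :
    weightedLaplacian f u z * Real.exp (-f z) =
      ∑ i, fderiv ℝ (fun y => Real.exp (-f y) * fderiv ℝ u y (EuclideanSpace.basisFun (Fin n) ℝ i))
        z (EuclideanSpace.basisFun (Fin n) ℝ i) := by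
  rw [weightedLaplacian, laplacian_eq_sum_fderiv (hu.of_le (by norm_cast)).contDiffAt,
    inner_gradient_eq_sum_fderiv, ← Finset.sum_sub_distrib, Finset.sum_mul]
  refine Finset.sum_congr rfl fun i _ => ?_
  set w := EuclideanSpace.basisFun (Fin n) ℝ i
  have h1 : HasFDerivAt (fun y => Real.exp (-f y)) (Real.exp (-f z) • -fderiv ℝ f z) z :=
    ((hf.differentiable (by simp) z).hasFDerivAt.neg).exp
  have h2 : ContDiff ℝ ∞ fun y => fderiv ℝ u y w :=
    (hu.fderiv_right (by simp)).clm_apply contDiff_const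
  rw [(h1.fun_mul (h2.differentiable (by simp) z).hasFDerivAt).fderiv]
  simp
  ring

/-- The weighted Laplacian is symmetric with respect to `e^{-f} 𝓛ⁿ`. -/
lemma integral_weightedLaplacian_mul_comm {f u w : EuclideanSpace ℝ (Fin n) → ℝ}
    (hf : ContDiff ℝ ∞ f) (hu : ContDiff ℝ ∞ u) (hw : ContDiff ℝ ∞ w)
    (hc : HasCompactSupport w) :
    ∫ z, weightedLaplacian f u z * w z * Real.exp (-f z) =
      ∫ z, u z * weightedLaplacian f w z * Real.exp (-f z) := by
  have hd : ∀ {g : EuclideanSpace ℝ (Fin n) → ℝ}, ContDiff ℝ ∞ g →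
      ∀ v, ContDiff ℝ ∞ fun y => fderiv ℝ g y v := fun hg v =>
    (hg.fderiv_right (by simp)).clm_apply contDiff_const
  have hA : ∀ {g : EuclideanSpace ℝ (Fin n) → ℝ}, ContDiff ℝ ∞ g →
      ∀ v, ContDiff ℝ ∞ fun y => Real.exp (-f y) * fderiv ℝ g y v := fun hg v =>
    hf.neg.exp.mul (hd hg v)
  have hcA : ∀ v, HasCompactSupport fun y => Real.exp (-f y) * fderiv ℝ w y v := fun v =>
    (hc.fderiv_apply ℝ v).mul_left
  have e1 : ∀ z, weightedLaplacian f u z * w z * Real.exp (-f z) =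
      ∑ i, fderiv ℝ (fun y => Real.exp (-f y) * fderiv ℝ u y (EuclideanSpace.basisFun (Fin n) ℝ i))
        z (EuclideanSpace.basisFun (Fin n) ℝ i) * w z := by
    intro z
    rw [mul_right_comm, weightedLaplacian_mul_exp_neg hf hu, Finset.sum_mul]
  have e2 : ∀ z, u z * weightedLaplacian f w z * Real.exp (-f z) =
      ∑ i, u z * fderiv ℝ (fun y => Real.exp (-f y) *
        fderiv ℝ w y (EuclideanSpace.basisFun (Fin n) ℝ i)) z
          (EuclideanSpace.basisFun (Fin n) ℝ i) := by
    intro z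
    rw [mul_assoc, weightedLaplacian_mul_exp_neg hf hw, Finset.mul_sum]
  simp only [e1, e2]
  rw [integral_finsetSum, integral_finsetSum]
  · refine Finset.sum_congr rfl fun i _ => ?_
    set v := EuclideanSpace.basisFun (Fin n) ℝ i
    rw [integral_mul_fderiv_eq_neg_of_hasCompactSupport (hu.of_le (by norm_cast))
      ((hA hw v).of_le (by norm_cast)) (hcA v), ← neg_eq_iff_eq_neg,
      ← integral_mul_fderiv_eq_neg_of_hasCompactSupport ((hA hu v).of_le (by norm_cast))
        (hw.of_le (by norm_cast)) hc]
    refine integral_congr_ae (Eventually.of_forall fun z => ?_)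
    simp only
    ring
  · intro i _
    exact (hu.continuous.mul (hd (hA hw _) _).continuous).integrable_of_hasCompactSupport
      ((hcA _).fderiv_apply ℝ _).mul_left
  · intro i _
    exact ((hd (hA hu _) _).continuous.mul hw.continuous).integrable_of_hasCompactSupport
      hc.mul_left

end IntegrationByParts

section ParametricIntegral

variable {n : ℕ}

/-- Differentiation under the integral sign for a `C¹` family of functions supported in a common
ball. -/
lemma hasDerivAt_integral_of_contDiffOn {Φ : ℝ → EuclideanSpace ℝ (Fin n) → ℝ} {a b R : ℝ}
    (hΦ : ContDiffOn ℝ 1 (fun q : ℝ × EuclideanSpace ℝ (Fin n) => Φ q.1 q.2)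
      (Set.Ioo a b ×ˢ Set.univ))
    (hsupp : ∀ s ∈ Set.Ioo a b, ∀ z, R < ‖z‖ → Φ s z = 0) {s : ℝ} (hs : s ∈ Set.Ioo a b) :
    HasDerivAt (fun s => ∫ z, Φ s z) (∫ z, deriv (fun r => Φ r z) s) s := by
  have hopen : IsOpen (Set.Ioo a b ×ˢ (Set.univ : Set (EuclideanSpace ℝ (Fin n)))) :=
    isOpen_Ioo.prod isOpen_univ
  have hdiff : ∀ r ∈ Set.Ioo a b, ∀ z, HasDerivAt (fun r => Φ r z)
      (fderiv ℝ (fun q : ℝ × EuclideanSpace ℝ (Fin n) => Φ q.1 q.2) (r, z) (1, 0)) r := by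
    intro r hr z
    have h1 := ((hΦ.contDiffAt (hopen.mem_nhds ⟨hr, trivial⟩ : _ ∈ 𝓝 (r, z))).differentiableAt
      (by norm_num)).hasFDerivAt
    have h2 : HasDerivAt (fun r : ℝ => (r, z)) ((1 : ℝ), (0 : EuclideanSpace ℝ (Fin n))) r :=
      (hasDerivAt_id r).prodMk (hasDerivAt_const r z)
    exact h1.comp_hasDerivAt r h2
  have hcont' : ContinuousOn (fun q : ℝ × EuclideanSpace ℝ (Fin n) => deriv (fun r => Φ r q.2) q.1)
      (Set.Ioo a b ×ˢ Set.univ) := by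
    refine ((hΦ.continuousOn_fderiv_of_isOpen hopen (by norm_num)).clm_apply
      (continuousOn_const (c := ((1 : ℝ), (0 : EuclideanSpace ℝ (Fin n)))))).congr fun q hq => ?_
    exact (hdiff q.1 hq.1 q.2).deriv
  have hslice : ∀ {G : ℝ × EuclideanSpace ℝ (Fin n) → ℝ},
      ContinuousOn G (Set.Ioo a b ×ˢ Set.univ) → ∀ r ∈ Set.Ioo a b,
        Continuous fun z => G (r, z) := fun hG r hr =>
    hG.comp_continuous (by fun_prop) fun z => ⟨hr, trivial⟩
  have hsupp' : ∀ r ∈ Set.Ioo a b, ∀ z, R < ‖z‖ → deriv (fun r => Φ r z) r = 0 := by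
    intro r hr z hz
    have : (fun r => Φ r z) =ᶠ[𝓝 r] fun _ => 0 := by
      filter_upwards [isOpen_Ioo.mem_nhds hr] with r' hr' using hsupp r' hr' z hz
    rw [this.deriv_eq, deriv_const]
  obtain ⟨δ, hδ, hball⟩ := Metric.isOpen_iff.1 isOpen_Ioo s hs
  have hsub : Metric.closedBall s (δ / 2) ⊆ Set.Ioo a b :=
    (Metric.closedBall_subset_ball (by linarith)).trans hball
  obtain ⟨C, hC⟩ := ((isCompact_closedBall s (δ / 2)).prod
    (isCompact_closedBall (0 : EuclideanSpace ℝ (Fin n)) R)).exists_bound_of_continuousOn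
      (hcont'.mono (Set.prod_mono hsub (Set.subset_univ _)))
  refine (hasDerivAt_integral_of_dominated_loc_of_deriv_le
    (F' := fun r z => deriv (fun r => Φ r z) r)
    (bound := (Metric.closedBall (0 : EuclideanSpace ℝ (Fin n)) R).indicator fun _ => C)
    (Metric.closedBall_mem_nhds s (half_pos hδ)) ?_ ?_ ?_ ?_ ?_ ?_).2
  · filter_upwards [isOpen_Ioo.mem_nhds hs] with r hr
    exact (hslice hΦ.continuousOn r hr).aestronglyMeasurable
  · refine (hslice hΦ.continuousOn s hs).integrable_of_hasCompactSupport
      (HasCompactSupport.intro (isCompact_closedBall 0 R) fun z hz => hsupp s hs z ?_)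
    simpa using hz
  · exact (hslice hcont' s hs).aestronglyMeasurable
  · refine Eventually.of_forall fun z r hr => ?_
    by_cases hz : z ∈ Metric.closedBall (0 : EuclideanSpace ℝ (Fin n)) R
    · rw [Set.indicator_of_mem hz]
      exact hC (r, z) ⟨hr, hz⟩
    · rw [Set.indicator_of_notMem hz, hsupp' r (hsub hr) z (by simpa using hz), norm_zero]
  · exact (continuousOn_const.integrableOn_compact
      (isCompact_closedBall _ _)).integrable_indicator Metric.isClosed_closedBall.measurableSet
  · refine Eventually.of_forall fun z r hr => ?_
    have h := hdiff r (hsub hr) z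
    rwa [← h.deriv] at h

end ParametricIntegral

/-! ### Comparison with subsolutions of the backward equation -/

section Comparison

variable {n : ℕ}

lemma contDiff_slice {Φ : ℝ → EuclideanSpace ℝ (Fin n) → ℝ} {I : Set ℝ}
    (hΦ : ContDiffOn ℝ ∞ (fun q : ℝ × EuclideanSpace ℝ (Fin n) => Φ q.1 q.2) (I ×ˢ Set.univ))
    {s : ℝ} (hs : s ∈ I) : ContDiff ℝ ∞ (Φ s) := by
  rw [← contDiffOn_univ]
  exact hΦ.comp (f := fun z => (s, z)) (by fun_prop) fun z _ => ⟨hs, trivial⟩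

lemma differentiableAt_slice {Φ : ℝ → EuclideanSpace ℝ (Fin n) → ℝ} {I : Set ℝ} (hI : IsOpen I)
    (hΦ : ContDiffOn ℝ ∞ (fun q : ℝ × EuclideanSpace ℝ (Fin n) => Φ q.1 q.2) (I ×ˢ Set.univ))
    {s : ℝ} (hs : s ∈ I) (z : EuclideanSpace ℝ (Fin n)) :
    DifferentiableAt ℝ (fun r => Φ r z) s := by
  have h : ContDiffOn ℝ ∞ (fun r => Φ r z) I :=
    hΦ.comp (f := fun r => (r, z)) (by fun_prop) fun r hr => ⟨hr, trivial⟩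
  exact (h.contDiffAt (hI.mem_nhds hs)).differentiableAt (by simp)

/-- Pairing a fundamental solution `u` with source `x` against a compactly supported subsolution
`w` of the backward equation gives a non-decreasing function of time, whose limit at time `0` is
`w 0 x`. -/
lemma IsFundamentalSolution.le_integral_mul {f : EuclideanSpace ℝ (Fin n) → ℝ}
    {x : EuclideanSpace ℝ (Fin n)} {u w : ℝ → EuclideanSpace ℝ (Fin n) → ℝ} {a T b R : ℝ}
    (hf : ContDiff ℝ ∞ f) (hu : IsFundamentalSolution f x u) (ha : a < 0) (hT : 0 < T) (hTb : T < b)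
    (hw : ContDiffOn ℝ ∞ (fun q : ℝ × EuclideanSpace ℝ (Fin n) => w q.1 q.2)
      (Set.Ioo a b ×ˢ Set.univ))
    (hsupp : ∀ s ∈ Set.Ioo a b, ∀ z, R < ‖z‖ → w s z = 0)
    (hsub : ∀ s ∈ Set.Ioo a b, ∀ z, 0 ≤ deriv (fun r => w r z) s + weightedLaplacian f (w s) z) :
    w 0 x ≤ ∫ z, u T z * w T z * Real.exp (-f z) := by
  wlog hR : 0 < R generalizing R
  · exact this (R := 1) (fun s hs z hz => hsupp s hs z (by linarith)) one_pos
  have hsub0 : Set.Ioo 0 b ⊆ Set.Ioo a b := Set.Ioo_subset_Ioo_left ha.le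
  have hwslice : ∀ s ∈ Set.Ioo a b, ContDiff ℝ ∞ (w s) := fun s hs => contDiff_slice hw hs
  have huslice : ∀ s, 0 < s → ContDiff ℝ ∞ (u s) := fun s hs => contDiff_slice hu.smooth hs
  have hwc : ∀ s ∈ Set.Ioo a b, HasCompactSupport (w s) := fun s hs =>
    HasCompactSupport.intro (isCompact_closedBall 0 R) fun z hz =>
      hsupp s hs z (by simpa using hz)
  -- Monotonicity: by symmetry of `Δ_f` the derivative of the pairing is `∫ u (∂ₛ w + Δ_f w) e^{-f}`.
  have hderiv : ∀ s ∈ Set.Ioo 0 b, HasDerivAt (fun s => ∫ z, u s z * w s z * Real.exp (-f z))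
      (∫ z, deriv (fun r => u r z * w r z * Real.exp (-f z)) s) s := by
    intro s hs
    refine hasDerivAt_integral_of_contDiffOn (R := R) ?_ (fun r hr z hz => ?_) hs
    · refine ((ContDiffOn.mul (hu.smooth.mono ?_) (hw.mono ?_)).mul ?_).of_le (by norm_cast)
      · exact Set.prod_mono Set.Ioo_subset_Ioi_self le_rfl
      · exact Set.prod_mono hsub0 le_rfl
      · exact ((hf.comp contDiff_snd).neg.exp).contDiffOn
    · rw [hsupp r (hsub0 hr) z hz, mul_zero, zero_mul]
  have hnonneg : ∀ s ∈ Set.Ioo 0 b,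
      0 ≤ ∫ z, deriv (fun r => u r z * w r z * Real.exp (-f z)) s := by
    intro s hs
    have hs' := hsub0 hs
    have hcw' : Continuous fun z => deriv (fun r => w r z) s := by
      have hopen : IsOpen (Set.Ioo a b ×ˢ (Set.univ : Set (EuclideanSpace ℝ (Fin n)))) :=
        isOpen_Ioo.prod isOpen_univ
      have h1 : ∀ z, deriv (fun r => w r z) s = fderiv ℝ
          (fun q : ℝ × EuclideanSpace ℝ (Fin n) => w q.1 q.2) (s, z) (1, 0) := by
        intro z
        have h1 := ((hw.contDiffAt (hopen.mem_nhds ⟨hs', trivial⟩ :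
          _ ∈ 𝓝 (s, z))).differentiableAt (by simp)).hasFDerivAt
        have h2 : HasDerivAt (fun r : ℝ => (r, z)) ((1 : ℝ), (0 : EuclideanSpace ℝ (Fin n))) s :=
          (hasDerivAt_id s).prodMk (hasDerivAt_const s z)
        exact (h1.comp_hasDerivAt s h2).deriv
      simp only [h1]
      exact ((hw.continuousOn_fderiv_of_isOpen hopen (by simp)).comp_continuous
        (by fun_prop) fun z => ⟨hs', trivial⟩).clm_apply continuous_const
    have hw'c : HasCompactSupport fun z => deriv (fun r => w r z) s := by
      refine HasCompactSupport.intro (isCompact_closedBall 0 R) fun z hz => ?_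
      have : (fun r => w r z) =ᶠ[𝓝 s] fun _ => 0 := by
        filter_upwards [isOpen_Ioo.mem_nhds hs'] with r hr
          using hsupp r hr z (by simpa using hz)
      rw [this.deriv_eq, deriv_const]
    have hcL : ∀ {g : EuclideanSpace ℝ (Fin n) → ℝ}, ContDiff ℝ ∞ g →
        Continuous fun z => weightedLaplacian f g z := by
      intro g hg
      have h1 : ∀ z, weightedLaplacian f g z * Real.exp (-f z) * Real.exp (f z) =
          weightedLaplacian f g z := fun z => by
        rw [mul_assoc, ← Real.exp_add]; simp
      refine Continuous.congr ?_ h1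
      simp only [weightedLaplacian_mul_exp_neg hf hg]
      refine Continuous.mul (continuous_finsetSum _ fun i _ => ?_) hf.continuous.rexp
      exact (((hf.neg.exp.mul ((hg.fderiv_right (m := ∞) (by simp)).clm_apply
        contDiff_const)).continuous_fderiv (by simp)).clm_apply continuous_const)
    have hexp : Continuous fun z => Real.exp (-f z) := hf.continuous.neg.rexp
    have e1 : ∀ z, deriv (fun r => u r z * w r z * Real.exp (-f z)) s =
        weightedLaplacian f (u s) z * w s z * Real.exp (-f z) +
          u s z * deriv (fun r => w r z) s * Real.exp (-f z) := by
      intro z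
      have h1 := (differentiableAt_slice isOpen_Ioi hu.smooth hs.1 z).hasDerivAt
      rw [hu.heat_eq s hs.1 z] at h1
      have h2 := (differentiableAt_slice isOpen_Ioo hw hs' z).hasDerivAt
      rw [((h1.fun_mul h2).mul_const _).deriv]
      ring
    have i1 : Integrable fun z => weightedLaplacian f (u s) z * w s z * Real.exp (-f z) :=
      (((hcL (huslice s hs.1)).mul (hwslice s hs').continuous).mul
        hexp).integrable_of_hasCompactSupport (hwc s hs').mul_left.mul_right
    have i2 : Integrable fun z => u s z * deriv (fun r => w r z) s * Real.exp (-f z) :=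
      ((((huslice s hs.1).continuous).mul hcw').mul hexp).integrable_of_hasCompactSupport
        hw'c.mul_left.mul_right
    have i3 : Integrable fun z => u s z * weightedLaplacian f (w s) z * Real.exp (-f z) := by
      refine (((huslice s hs.1).continuous.mul (hcL (hwslice s hs'))).mul
        hexp).integrable_of_hasCompactSupport (HasCompactSupport.mul_right
          (HasCompactSupport.mul_left ?_))
      refine HasCompactSupport.intro (isCompact_closedBall 0 R) fun z hz => ?_
      have h0 : w s =ᶠ[𝓝 z] fun _ => 0 := by
        filter_upwards [Metric.isClosed_closedBall.isOpen_compl.mem_nhds hz] with y hy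
          using hsupp s hs' y (by simpa using hy)
      rw [weightedLaplacian, InnerProductSpace.laplacian_congr_nhds h0 |>.eq_of_nhds, h0.gradient_eq]
      simp
    simp only [e1]
    rw [integral_add i1 i2, integral_weightedLaplacian_mul_comm hf (huslice s hs.1)
      (hwslice s hs') (hwc s hs'), ← integral_add i3 i2]
    refine integral_nonneg fun z => ?_
    have h := mul_nonneg (mul_nonneg (hu.nonneg s hs.1 z) (hsub s hs' z)) (Real.exp_pos (-f z)).le
    simp only [Pi.zero_apply]
    linarith
  have hmono : MonotoneOn (fun s => ∫ z, u s z * w s z * Real.exp (-f z)) (Set.Ioo 0 b) := by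
    refine monotoneOn_of_deriv_nonneg (convex_Ioo 0 b)
      (fun s hs => (hderiv s hs).continuousAt.continuousWithinAt) ?_ ?_
    · rw [interior_Ioo]
      exact fun s hs => (hderiv s hs).differentiableAt.differentiableWithinAt
    · rw [interior_Ioo]
      intro s hs
      rw [(hderiv s hs).deriv]
      exact hnonneg s hs
  -- Limit at time `0`: replace `w s` by the test function `w 0 - θ ψ ≤ w s`.
  have h0 : (0 : ℝ) ∈ Set.Ioo a b := ⟨ha, hT.trans hTb⟩
  let ψ : ContDiffBump (0 : EuclideanSpace ℝ (Fin n)) := ⟨R, R + 1, hR, by linarith⟩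
  have hψ : ContDiff ℝ ∞ ψ := ψ.contDiff
  refine le_of_forall_pos_le_add fun η hη => ?_
  set θ := η / (ψ x + 1) with hθ
  have hψx : 0 ≤ ψ x := ψ.nonneg
  have hθ0 : 0 < θ := by positivity
  have hunif : ∀ᶠ s in 𝓝[>] (0 : ℝ), ∀ z ∈ Metric.closedBall (0 : EuclideanSpace ℝ (Fin n)) R,
      dist (w 0 z) (w s z) < θ := by
    have hsub' : Set.Icc (a / 2) (T) ⊆ Set.Ioo a b := fun s hs =>
      ⟨by linarith [hs.1], by linarith [hs.2]⟩
    have hcomp := (isCompact_Icc (a := a / 2) (b := T)).prod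
      (isCompact_closedBall (0 : EuclideanSpace ℝ (Fin n)) R)
    have huc : UniformContinuousOn (fun q : ℝ × EuclideanSpace ℝ (Fin n) => w q.1 q.2)
        (Set.Icc (a / 2) T ×ˢ Metric.closedBall 0 R) :=
      hcomp.uniformContinuousOn_of_continuous
        (hw.continuousOn.mono (Set.prod_mono hsub' (Set.subset_univ _)))
    have h1 := UniformContinuousOn.tendstoUniformlyOn (F := w) huc
      (x := 0) ⟨by linarith, hT.le⟩
    have h2 := Metric.tendstoUniformlyOn_iff.1 h1 θ hθ0
    have h3 : Set.Icc (a / 2) T ∈ 𝓝 (0 : ℝ) := Icc_mem_nhds (by linarith) hT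
    rw [nhdsWithin_eq_nhds.2 h3] at h2
    exact h2.filter_mono nhdsWithin_le_nhds
  have hlim := hu.initial (fun z => w 0 z - θ * ψ z) ((hwslice 0 h0).sub (contDiff_const.mul hψ))
    ((hwc 0 h0).sub ψ.hasCompactSupport.mul_left)
  have hle : w 0 x - θ * ψ x ≤ ∫ z, u T z * w T z * Real.exp (-f z) := by
    refine le_of_tendsto hlim ?_
    filter_upwards [hunif, Ioo_mem_nhdsGT hT] with s hs hsT
    have hsb : s ∈ Set.Ioo 0 b := ⟨hsT.1, hsT.2.trans hTb⟩
    refine le_trans ?_ (hmono hsb ⟨hT, hTb⟩ hsT.2.le)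
    rw [integral_weightedMeasure hf.continuous]
    have hexp : Continuous fun z => Real.exp (-f z) := hf.continuous.neg.rexp
    refine integral_mono ?_ ?_ fun z => ?_
    · exact (((huslice s hsT.1).continuous.mul ((hwslice 0 h0).continuous.sub
        (continuous_const.mul hψ.continuous))).mul hexp).integrable_of_hasCompactSupport
          ((hwc 0 h0).sub ψ.hasCompactSupport.mul_left).mul_left.mul_right
    · exact (((huslice s hsT.1).continuous.mul
        (hwslice s (hsub0 hsb)).continuous).mul hexp).integrable_of_hasCompactSupport
          (hwc s (hsub0 hsb)).mul_left.mul_right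
    · refine mul_le_mul_of_nonneg_right (mul_le_mul_of_nonneg_left ?_ (hu.nonneg s hsT.1 z))
        (Real.exp_pos _).le
      by_cases hz : z ∈ Metric.closedBall (0 : EuclideanSpace ℝ (Fin n)) R
      · have h1 := hs z hz
        rw [Real.dist_eq] at h1
        have h2 := (abs_lt.1 h1).2
        have h3 : ψ z = 1 := ψ.one_of_mem_closedBall hz
        rw [h3]; linarith
      · have hz' : R < ‖z‖ := by simpa using hz
        rw [hsupp s (hsub0 hsb) z hz', hsupp 0 h0 z hz']
        have : 0 ≤ θ * ψ z := mul_nonneg hθ0.le ψ.nonneg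
        linarith
  have hη' : θ * ψ x ≤ η := by
    rw [hθ, div_mul_eq_mul_div, div_le_iff₀ (by positivity)]
    exact mul_le_mul_of_nonneg_left (by linarith) hη.le
  linarith

end Comparison

/-! ### Minimality of the Mehler kernel -/

section Minimality

variable {n : ℕ} (k : ℝ) (b : EuclideanSpace ℝ (Fin n)) (c : ℝ)

/-- The Mehler kernel as a Gaussian in the backward variable. -/
lemma mehlerKernel_eq_backward {t : ℝ} (ht : 0 < t) (y z : EuclideanSpace ℝ (Fin n)) :
    mehlerKernel k b c t y z = Real.exp (quadraticPotential k b c y) *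
      (2 * Real.pi * ouVariance k t) ^ (-((n : ℝ) / 2)) *
      Real.exp (-(‖y + expIntegral k t • b - Real.exp (-(k * t)) • z‖ ^ 2 /
        (2 * ouVariance k t))) := by
  rw [mehlerKernel_comm k b c ht, mehlerKernel, gaussianDensity, ouMean_quadraticPotential,
    ← sub_add, sub_add_eq_add_sub, mul_assoc (Real.exp _)]

/-- The Mehler kernel tends to `0` at spatial infinity, uniformly for `t` in compact subsets of
`(0, ∞)`. -/
lemma exists_forall_mehlerKernel_le (y : EuclideanSpace ℝ (Fin n)) {t₀ t₁ ε : ℝ} (ht₀ : 0 < t₀)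
    (hε : 0 < ε) :
    ∃ R, ∀ t ∈ Set.Icc t₀ t₁, ∀ z, R < ‖z‖ → mehlerKernel k b c t y z ≤ ε := by
  set A : ℝ → ℝ := fun t => Real.exp (quadraticPotential k b c y) *
      (2 * Real.pi * ouVariance k t) ^ (-((n : ℝ) / 2)) with hA
  have hv := (contDiff_ouVariance k).continuous
  have ha := (contDiff_expIntegral k).continuous
  have hpos : ∀ t ∈ Set.Icc t₀ t₁, 0 < t := fun t ht => ht₀.trans_le ht.1
  have hAc : ContinuousOn A (Set.Icc t₀ t₁) := by
    refine continuousOn_const.mul (ContinuousOn.rpow_const (by fun_prop) fun t ht => Or.inl ?_)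
    have := ouVariance_pos k (hpos t ht)
    positivity
  have hRc : ContinuousOn (fun t => (‖y + expIntegral k t • b‖ +
      √(2 * ouVariance k t * (A t / ε))) / Real.exp (-(k * t))) (Set.Icc t₀ t₁) := by
    refine ContinuousOn.div (ContinuousOn.add (by fun_prop) ?_) (by fun_prop)
      fun t _ => (Real.exp_pos _).ne'
    exact (ContinuousOn.mul (by fun_prop) (hAc.div_const ε)).sqrt
  obtain ⟨R, hR⟩ := isCompact_Icc.bddAbove_image hRc
  refine ⟨R, fun t ht z hz => ?_⟩
  have hvt := ouVariance_pos k (hpos t ht)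
  have hAt : 0 < A t := by positivity
  have h1 : (‖y + expIntegral k t • b‖ + √(2 * ouVariance k t * (A t / ε))) /
      Real.exp (-(k * t)) < ‖z‖ := (hR ⟨t, ht, rfl⟩).trans_lt hz
  rw [div_lt_iff₀ (Real.exp_pos _)] at h1
  rw [mehlerKernel_eq_backward k b c (hpos t ht)]
  set e := Real.exp (-(k * t))
  set q := y + expIntegral k t • b
  have h2 : √(2 * ouVariance k t * (A t / ε)) < ‖q - e • z‖ := by
    have h3 := norm_sub_norm_le (e • z) q
    rw [norm_smul, Real.norm_of_nonneg (Real.exp_pos _).le, norm_sub_rev] at h3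
    linarith
  have h3 : 2 * ouVariance k t * (A t / ε) < ‖q - e • z‖ ^ 2 :=
    (Real.sqrt_lt' ((Real.sqrt_nonneg _).trans_lt h2)).1 h2
  have h4 : A t / ε ≤ ‖q - e • z‖ ^ 2 / (2 * ouVariance k t) := by
    rw [le_div_iff₀ (by positivity)]; linarith
  -- `e^X ≥ 1 + X` turns the lower bound `A / ε` for the exponent into `A e^{-X} ≤ ε`.
  have h5 := Real.add_one_le_exp (‖q - e • z‖ ^ 2 / (2 * ouVariance k t))
  change A t * _ ≤ ε
  rw [Real.exp_neg, ← div_eq_mul_inv, div_le_iff₀ (Real.exp_pos _), ← div_le_iff₀' hε]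
  linarith

/-- As `t → 0⁺`, the Mehler kernel tends to `0` uniformly outside every ball around its source. -/
lemma eventually_forall_mehlerKernel_le (y : EuclideanSpace ℝ (Fin n)) {r ε : ℝ} (hr : 0 < r)
    (hε : 0 < ε) :
    ∀ᶠ t in 𝓝[>] (0 : ℝ), ∀ z, r ≤ dist z y → mehlerKernel k b c t y z ≤ ε := by
  have hv := (contDiff_ouVariance k).continuous
  have ha := (contDiff_expIntegral k).continuous
  -- For `|z - y| ≥ r`, the point `e^{-kt} z - a b` has distance at least
  -- `e^{-kt} r - |(1 - e^{-kt}) y + a b|` from `y`, where `a = expIntegral k t`.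
  have h1 : ∀ᶠ t in 𝓝[>] (0 : ℝ), r / 2 < Real.exp (-(k * t)) * r -
      ‖(1 - Real.exp (-(k * t))) • y + expIntegral k t • b‖ := by
    have hc : Continuous fun t => Real.exp (-(k * t)) * r -
      ‖(1 - Real.exp (-(k * t))) • y + expIntegral k t • b‖ := by fun_prop
    have h := hc.tendsto 0
    simp only [mul_zero, neg_zero, Real.exp_zero, one_mul, sub_self, zero_smul, expIntegral_zero,
      add_zero, norm_zero, sub_zero] at h
    exact (h.mono_left nhdsWithin_le_nhds).eventually (lt_mem_nhds (by linarith))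
  have h2 : ∀ᶠ t in 𝓝[>] (0 : ℝ), Real.exp (quadraticPotential k b c y) *
      (2 * Real.pi) ^ (-((n : ℝ) / 2)) * ((ouVariance k t)⁻¹ ^ ((n : ℝ) / 2) *
        Real.exp (-(r ^ 2 / 8) * (ouVariance k t)⁻¹)) < ε := by
    have h3 : Tendsto (ouVariance k) (𝓝[>] 0) (𝓝[>] 0) := by
      refine tendsto_nhdsWithin_iff.2 ⟨?_, eventually_nhdsWithin_of_forall fun t ht =>
        ouVariance_pos k ht⟩
      have := hv.tendsto 0
      rw [ouVariance_zero] at this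
      exact this.mono_left nhdsWithin_le_nhds
    have h4 := ((tendsto_rpow_mul_exp_neg_mul_atTop_nhds_zero ((n : ℝ) / 2) (r ^ 2 / 8)
      (by positivity)).comp (tendsto_inv_nhdsGT_zero.comp h3)).const_mul
        (Real.exp (quadraticPotential k b c y) * (2 * Real.pi) ^ (-((n : ℝ) / 2)))
    rw [mul_zero] at h4
    exact h4.eventually (gt_mem_nhds hε)
  filter_upwards [h1, h2, self_mem_nhdsWithin] with t h1 h2 ht z hz
  have hvt := ouVariance_pos k ht
  refine le_trans ?_ h2.le
  rw [mehlerKernel_eq_backward k b c ht, Real.mul_rpow (by positivity) hvt.le,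
    Real.inv_rpow hvt.le, ← Real.rpow_neg hvt.le, ← mul_assoc, ← mul_assoc]
  refine mul_le_mul_of_nonneg_left (Real.exp_le_exp.2 ?_) (by positivity)
  set e := Real.exp (-(k * t))
  have h3 : r / 2 ≤ ‖y + expIntegral k t • b - e • z‖ := by
    have h4 := norm_sub_norm_le (e • (z - y)) ((1 - e) • y + expIntegral k t • b)
    rw [norm_smul, Real.norm_of_nonneg (Real.exp_pos _).le, ← dist_eq_norm z y, norm_sub_rev,
      show (1 - e) • y + expIntegral k t • b - e • (z - y) =
        y + expIntegral k t • b - e • z by module] at h4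
    have h5 := mul_le_mul_of_nonneg_left hz (Real.exp_pos (-(k * t))).le
    linarith
  have h4 : (r / 2) ^ 2 ≤ ‖y + expIntegral k t • b - e • z‖ ^ 2 := by gcongr
  rw [neg_mul, neg_le_neg_iff, ← div_eq_mul_inv, div_div, div_le_div_iff₀ (by positivity)
    (by positivity)]
  nlinarith

lemma integrable_mehlerKernel_mul_exp_neg {t : ℝ} (ht : 0 < t) (y : EuclideanSpace ℝ (Fin n)) :
    Integrable fun z => mehlerKernel k b c t y z * Real.exp (-quadraticPotential k b c z) := by
  simp only [mehlerKernel_mul_exp_neg]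
  exact integrable_gaussianDensity (ouVariance_pos k ht) _

lemma integral_mehlerKernel_mul_exp_neg {t : ℝ} (ht : 0 < t) (y : EuclideanSpace ℝ (Fin n)) :
    ∫ z, mehlerKernel k b c t y z * Real.exp (-quadraticPotential k b c z) = 1 := by
  simp only [mehlerKernel_mul_exp_neg]
  exact integral_gaussianDensity (ouVariance_pos k ht) _

/-- A convex non-decreasing function of the time-reversed Mehler kernel is a subsolution of the
backward equation `∂ₛ w + Δ_f w = 0`. -/
lemma deriv_add_weightedLaplacian_convexCutoff_nonneg (y : EuclideanSpace ℝ (Fin n)) {τ s N ε : ℝ}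
    (hs : s < τ) (hN : 0 ≤ N) (z : EuclideanSpace ℝ (Fin n)) :
    0 ≤ deriv (fun r => convexCutoff (N * (mehlerKernel k b c (τ - r) y z - ε))) s +
      weightedLaplacian (quadraticPotential k b c)
        (fun z => convexCutoff (N * (mehlerKernel k b c (τ - s) y z - ε))) z := by
  have ht : 0 < τ - s := by linarith
  have hF : ∀ r, HasDerivAt (fun r => convexCutoff (N * (r - ε)))
      (N * ((1 + (N * (r - ε))⁻¹) * expNegInvGlue (N * (r - ε)))) r := by
    intro r
    have h1 : HasDerivAt (fun r => N * (r - ε)) (N * 1) r :=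
      ((hasDerivAt_id r).sub_const ε).const_mul N
    convert! (hasDerivAt_convexCutoff (N * (r - ε))).comp r h1 using 1
    ring
  have hF' : ∀ r, HasDerivAt
      (fun r => N * ((1 + (N * (r - ε))⁻¹) * expNegInvGlue (N * (r - ε))))
      (N * N * ((N * (r - ε))⁻¹ ^ 3 * expNegInvGlue (N * (r - ε)))) r := by
    intro r
    have h1 : HasDerivAt (fun r => N * (r - ε)) (N * 1) r :=
      ((hasDerivAt_id r).sub_const ε).const_mul N
    convert! ((hasDerivAt_deriv_convexCutoff (N * (r - ε))).comp r h1).const_mul N using 1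
    ring
  have hF2 : ContDiff ℝ 2 fun r => convexCutoff (N * (r - ε)) :=
    (contDiff_convexCutoff.comp (by fun_prop)).of_le (by norm_cast)
  have hh : ContDiff ℝ 2 (mehlerKernel k b c (τ - s) y) :=
    (contDiff_slice (Φ := fun t z => mehlerKernel k b c t y z)
      (contDiffOn_mehlerKernel k b c y) ht).of_le (by norm_cast)
  rw [weightedLaplacian_comp _ hh hF hF' hF2]
  have htime : HasDerivAt (fun r => mehlerKernel k b c (τ - r) y z)
      (weightedLaplacian (quadraticPotential k b c) (mehlerKernel k b c (τ - s) y) z * -1) s :=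
    (hasDerivAt_mehlerKernel k b c ht y z).comp s ((hasDerivAt_id s).const_sub τ)
  have hcomp := (hF (mehlerKernel k b c (τ - s) y z)).comp s htime
  rw [show (fun r => convexCutoff (N * (mehlerKernel k b c (τ - r) y z - ε))) =
    (fun r => convexCutoff (N * (r - ε))) ∘ fun r => mehlerKernel k b c (τ - r) y z from rfl,
    hcomp.deriv]
  have h1 := mul_nonneg (mul_nonneg (mul_nonneg hN hN) (deriv_deriv_convexCutoff_nonneg
    (N * (mehlerKernel k b c (τ - s) y z - ε))))
      (sq_nonneg ‖gradient (mehlerKernel k b c (τ - s) y) z‖)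
  linarith

/-- Comparison of an arbitrary fundamental solution with a truncated time-reversed Mehler
kernel. -/
lemma convexCutoff_mehlerKernel_le_integral {x : EuclideanSpace ℝ (Fin n)}
    {u : ℝ → EuclideanSpace ℝ (Fin n) → ℝ}
    (hu : IsFundamentalSolution (quadraticPotential k b c) x u) (y : EuclideanSpace ℝ (Fin n))
    {T δ N ε : ℝ} (hT : 0 < T) (hδ : 0 < δ) (hN : 0 ≤ N) (hε : 0 < ε) :
    convexCutoff (N * (mehlerKernel k b c (T + δ) y x - ε)) ≤
      ∫ z, u T z * convexCutoff (N * (mehlerKernel k b c δ y z - ε)) *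
        Real.exp (-quadraticPotential k b c z) := by
  obtain ⟨R, hR⟩ := exists_forall_mehlerKernel_le k b c y (t₀ := δ / 2) (t₁ := T + δ + 1)
    (half_pos hδ) hε
  have h := hu.le_integral_mul (a := -1) (b := T + δ / 2) (R := R) (T := T)
    (w := fun s z => convexCutoff (N * (mehlerKernel k b c (T + δ - s) y z - ε)))
    (contDiff_quadraticPotential k b c) (by norm_num) hT (by linarith) ?_ ?_ ?_
  · simpa using h
  · refine contDiff_convexCutoff.comp_contDiffOn (contDiffOn_const.mul (ContDiffOn.sub ?_
      contDiffOn_const))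
    exact (contDiffOn_mehlerKernel k b c y).comp
      (f := fun q : ℝ × EuclideanSpace ℝ (Fin n) => (T + δ - q.1, q.2)) (by fun_prop)
      fun q hq => ⟨by have := hq.1.2; simp only [Set.mem_Ioi]; linarith, trivial⟩
  · intro s hs z hz
    refine convexCutoff_of_nonpos (mul_nonpos_of_nonneg_of_nonpos hN (sub_nonpos.2 ?_))
    exact hR _ ⟨by linarith [hs.2], by linarith [hs.1]⟩ z hz
  · intro s hs z
    exact deriv_add_weightedLaplacian_convexCutoff_nonneg k b c y (by linarith [hs.2]) hN z

/-- The Mehler kernel is the smallest non-negative fundamental solution. -/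
lemma mehlerKernel_le {x : EuclideanSpace ℝ (Fin n)} {u : ℝ → EuclideanSpace ℝ (Fin n) → ℝ}
    (hu : IsFundamentalSolution (quadraticPotential k b c) x u) {T : ℝ} (hT : 0 < T)
    (y : EuclideanSpace ℝ (Fin n)) :
    mehlerKernel k b c T x y ≤ u T y := by
  rw [mehlerKernel_comm k b c hT]
  refine le_of_forall_pos_le_add fun η hη => ?_
  -- The truncation level, the oscillation of `u T` near `y` and the error `1 / N` of the convex
  -- cutoff each account for `ε = η / 3`.
  set ε := η / 3 with hεη
  have hε : 0 < ε := by positivity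
  have huT : ContDiff ℝ ∞ (u T) := contDiff_slice hu.smooth hT
  obtain ⟨r, hr, hball⟩ := Metric.eventually_nhds_iff.1
    ((huT.continuous.tendsto y).eventually (gt_mem_nhds (show u T y < u T y + ε by linarith)))
  have hlim : Tendsto (fun δ => mehlerKernel k b c (T + δ) y x) (𝓝[>] 0)
      (𝓝 (mehlerKernel k b c T y x)) := by
    have h1 : ContinuousAt (fun δ => mehlerKernel k b c (T + δ) y x) 0 := by
      refine ContinuousAt.comp (g := fun t => mehlerKernel k b c t y x) ?_ (by fun_prop)
      rw [add_zero]
      exact (hasDerivAt_mehlerKernel k b c hT y x).continuousAt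
    have h2 : Tendsto _ _ (𝓝 _) := h1.tendsto
    rw [add_zero] at h2
    exact h2.mono_left nhdsWithin_le_nhds
  refine le_of_tendsto hlim ?_
  filter_upwards [eventually_forall_mehlerKernel_le k b c y hr hε, self_mem_nhdsWithin]
    with δ hδ hδ0
  have hδ0 : 0 < δ := hδ0
  have hN : 0 < ε⁻¹ := inv_pos.2 hε
  have h1 := convexCutoff_mehlerKernel_le_integral k b c hu y hT hδ0 hN.le hε
  have h2 := sub_one_le_convexCutoff (ε⁻¹ * (mehlerKernel k b c (T + δ) y x - ε))
  have h3 : ∫ z, u T z * convexCutoff (ε⁻¹ * (mehlerKernel k b c δ y z - ε)) *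
      Real.exp (-quadraticPotential k b c z) ≤ ∫ z, (u T y + ε) * ε⁻¹ *
        (mehlerKernel k b c δ y z * Real.exp (-quadraticPotential k b c z)) := by
    have hpos : ∀ z, 0 < mehlerKernel k b c δ y z := mehlerKernel_pos k b c hδ0 y
    have huy : 0 ≤ u T y + ε := add_nonneg (hu.nonneg T hT y) hε.le
    have hle : ∀ z, u T z * convexCutoff (ε⁻¹ * (mehlerKernel k b c δ y z - ε)) *
        Real.exp (-quadraticPotential k b c z) ≤ (u T y + ε) * ε⁻¹ *
          (mehlerKernel k b c δ y z * Real.exp (-quadraticPotential k b c z)) := by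
      intro z
      rw [← mul_assoc]
      refine mul_le_mul_of_nonneg_right ?_ (Real.exp_pos _).le
      rcases le_or_gt (mehlerKernel k b c δ y z) ε with hz | hz
      · rw [convexCutoff_of_nonpos (mul_nonpos_of_nonneg_of_nonpos hN.le (sub_nonpos.2 hz)),
          mul_zero]
        exact mul_nonneg (mul_nonneg huy hN.le) (hpos z).le
      · have hzy : dist z y < r := by
          by_contra! h
          exact hz.not_ge (hδ z h)
        have h0 : 0 ≤ ε⁻¹ * (mehlerKernel k b c δ y z - ε) :=
          mul_nonneg hN.le (sub_nonneg.2 hz.le)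
        rw [mul_assoc]
        calc u T z * convexCutoff (ε⁻¹ * (mehlerKernel k b c δ y z - ε))
            ≤ u T z * (ε⁻¹ * (mehlerKernel k b c δ y z - ε)) :=
              mul_le_mul_of_nonneg_left (convexCutoff_le h0) (hu.nonneg T hT z)
          _ ≤ (u T y + ε) * (ε⁻¹ * (mehlerKernel k b c δ y z - ε)) :=
              mul_le_mul_of_nonneg_right (hball hzy).le h0
          _ ≤ (u T y + ε) * (ε⁻¹ * mehlerKernel k b c δ y z) := by
              gcongr
              linarith
    refine integral_mono_of_nonneg (Eventually.of_forall fun z => ?_)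
      ((integrable_mehlerKernel_mul_exp_neg k b c hδ0 y).const_mul _) (Eventually.of_forall hle)
    refine mul_nonneg (mul_nonneg (hu.nonneg T hT z) ?_) (Real.exp_pos _).le
    rcases le_or_gt (ε⁻¹ * (mehlerKernel k b c δ y z - ε)) 0 with h | h
    · rw [convexCutoff_of_nonpos h]
    · exact mul_nonneg h.le (expNegInvGlue.nonneg _)
  rw [integral_const_mul, integral_mehlerKernel_mul_exp_neg k b c hδ0, mul_one] at h3
  have h4 := mul_le_mul_of_nonneg_left (h2.trans (h1.trans h3)) hε.le
  have h5 : ε * ((u T y + ε) * ε⁻¹) = u T y + ε := by field_simp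
  have h6 : ε * (ε⁻¹ * (mehlerKernel k b c (T + δ) y x - ε) - 1) =
      mehlerKernel k b c (T + δ) y x - ε - ε := by field_simp
  rw [h5, h6] at h4
  linarith

lemma isHeatKernel_mehlerKernel :
    IsHeatKernel (quadraticPotential k b c) (mehlerKernel k b c) := fun x =>
  ⟨isFundamentalSolution_mehlerKernel k b c x, fun _ hu _ ht y => mehlerKernel_le k b c hu ht y⟩

end Minimality

/-- The conditions defining the heat kernel determine it at positive times. -/
lemma IsHeatKernel.eq {n : ℕ} {f : EuclideanSpace ℝ (Fin n) → ℝ}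
    {p p' : ℝ → EuclideanSpace ℝ (Fin n) → EuclideanSpace ℝ (Fin n) → ℝ}
    (hp : IsHeatKernel f p) (hp' : IsHeatKernel f p') {t : ℝ} (ht : 0 < t)
    (x z : EuclideanSpace ℝ (Fin n)) : p t x z = p' t x z :=
  le_antisymm ((hp x).2 _ (hp' x).1 t ht z) ((hp' x).2 _ (hp x).1 t ht z)

/-! ### Sharp Wasserstein contraction -/

/-- Sharp Wasserstein contraction on weighted Euclidean spaces with `∇²f ≡ k Id`: the heat kernel
exists, it is the Ornstein–Uhlenbeck (Mehler) kernel, whose means are contracted by `e^{-kt}`, and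
`W_p(p_t(x,·), p_t(y,·)) = e^{-kt} |x - y|`. -/
theorem proposition3p5 (n : ℕ) (k : ℝ) (f : EuclideanSpace ℝ (Fin n) → ℝ)
    (hf : ContDiff ℝ 2 f)
    (hess : ∀ x v w : EuclideanSpace ℝ (Fin n),
      (fderiv ℝ (fderiv ℝ f) x v) w = k * inner ℝ v w) :
    (∃ p, IsHeatKernel f p) ∧
    ∀ p, IsHeatKernel f p → ∀ t : ℝ, 0 < t →
      (∀ x, IsProbabilityMeasure (heatKernelMeasure f p t x)) ∧
      (∀ x z, p t x z * Real.exp (-f z) =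
        (2 * Real.pi * ouVariance k t) ^ (-((n : ℝ) / 2)) *
          Real.exp (-(‖z - ouMean f k t x‖ ^ 2 / (2 * ouVariance k t)))) ∧
      (∀ x y, ouMean f k t x - ouMean f k t y = Real.exp (-(k * t)) • (x - y)) ∧
      (∀ x y, ∀ q : ℝ≥0∞, 1 ≤ q →
        wassersteinDist q (heatKernelMeasure f p t x) (heatKernelMeasure f p t y) =
          ENNReal.ofReal (Real.exp (-(k * t)) * ‖x - y‖)) := by
  obtain ⟨b, c, rfl⟩ := exists_eq_quadraticPotential hf hess
  have hker := isHeatKernel_mehlerKernel k b c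
  refine ⟨⟨_, hker⟩, fun p hp t ht => ?_⟩
  have hv := ouVariance_pos k ht
  have hdens : ∀ x z, p t x z * Real.exp (-quadraticPotential k b c z) =
      gaussianDensity (ouVariance k t) (ouMean (quadraticPotential k b c) k t x) z := fun x z => by
    rw [hp.eq hker ht, mehlerKernel_mul_exp_neg]
  have hmeas : ∀ x, heatKernelMeasure (quadraticPotential k b c) p t x =
      isotropicGaussian (ouVariance k t) (ouMean (quadraticPotential k b c) k t x) := fun x =>
    heatKernelMeasure_eq_isotropicGaussian (contDiff_quadraticPotential k b c).continuous (hdens x)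
  have hmean : ∀ x y, ouMean (quadraticPotential k b c) k t x -
      ouMean (quadraticPotential k b c) k t y = Real.exp (-(k * t)) • (x - y) := fun x y => by
    rw [ouMean_quadraticPotential, ouMean_quadraticPotential]; module
  refine ⟨fun x => ?_, hdens, hmean, fun x y q hq => ?_⟩
  · rw [hmeas]
    exact isProbabilityMeasure_isotropicGaussian hv _
  · rw [hmeas, hmeas, wassersteinDist_isotropicGaussian hv _ _ hq, hmean, ← ofReal_norm,
      norm_smul, Real.norm_of_nonneg (Real.exp_pos _).le]
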